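/- For every integer $k\ge 2$ let $G_k$ be the nested triangles graph on $n=3k$ vertices: its vertices are $v_{t,i}$ with $1\le t\le k$ and $i\in\{0,1,2\}$; for each $t$ the vertices $v_{t,0},v_{t,1},v_{t,2}$ form a triangle; for each $t<k$, $v_{t,i}$ is adjacent to $v_{t+1,j}$ exactly if $j\le i$; and there are no further edges. A graph is planar triangulated if it is a finite simple graph with a crossing-free drawing in the plane in which every face, including the outer face, is bounded by a simple cycle of length $3$. The pathwidth $\mathrm{pw}(G)$ is the smallest width of a path decomposition of $G$, where the width is the largest bag size minus $1$. A grid-representation of $G$ of height $h$ is a labelling of the points of a $W\times h$ grid (for some $W$; $W$ columns and $h$ rows, with an edge between any two grid points of distance one) by vertices of $G$ such that every vertex occurs as a label, the grid points with a given label induce a connected subgraph of the grid, and for every edge $vw$ of $G$ some grid edge has ends labelled $v$ and $w$. The grid-major height $\mathrm{GMh}(G)$ is the smallest $h$ such that $G$ has a grid-representation of height $h$. Then, for every $k\ge2$, the graph $G_k$ is planar triangulated, $\mathrm{pw}(G_k)=3$, and $$\mathrm{GMh}(G_k)\;\ge\;\frac n3-1 .$$ In particular there are planar triangulated graphs $G$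 with arbitrarily many vertices $n$, with $\mathrm{pw}(G)=3$ and $\mathrm{GMh}(G)\in\Omega(n)$. -/

import Mathlib

/-- A drawing of a simple graph in the plane without crossings: vertices are distinct points,
every edge is a simple arc between its two ends, an arc contains no vertex other than its ends,
and two different arcs meet only in the points of common ends. (The plane is `ℝ × ℝ`; only its
topology matters. The value of `arc` outside of the edge set is irrelevant.) -/
structure PlaneDrawing {V : Type*} (G : SimpleGraph V) where
  point : V → ℝ × ℝ
  point_injective : Function.Injective point
  arc : Sym2 V → Set (ℝ × ℝ)
  arc_isArc : ∀ u v : V, G.Adj u v →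
    ∃ γ : Path (point u) (point v), Function.Injective γ ∧ Set.range γ = arc s(u, v)
  vertex_on_arc : ∀ e ∈ G.edgeSet, ∀ v : V, point v ∈ arc e → v ∈ e
  arc_inter_arc : ∀ e ∈ G.edgeSet, ∀ e' ∈ G.edgeSet, e ≠ e' → ∀ x ∈ arc e ∩ arc e',
    ∃ v : V, v ∈ e ∧ v ∈ e' ∧ x = point v

namespace PlaneDrawing

/-- The set of all points of the plane that are covered by the drawing. -/
def support {V : Type*} {G : SimpleGraph V} (D : PlaneDrawing G) : Set (ℝ × ℝ) :=
  Set.range D.point ∪ ⋃ e ∈ G.edgeSet, D.arc e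

/-- The faces (including the outer face): the maximal connected regions that remain when the
drawing is removed from the plane. -/
def faces {V : Type*} {G : SimpleGraph V} (D : PlaneDrawing G) : Set (Set (ℝ × ℝ)) :=
  {F | ∃ x ∈ D.supportᶜ, F = connectedComponentIn D.supportᶜ x}

/-- Every face, including the outer face, is bounded by a simple cycle of length 3. -/
def IsTriangulated {V : Type*} {G : SimpleGraph V} (D : PlaneDrawing G) : Prop :=
  ∀ F ∈ D.faces, ∃ u v w : V, G.Adj u v ∧ G.Adj v w ∧ G.Adj u w ∧
    frontier F = D.arc s(u, v) ∪ D.arc s(v, w) ∪ D.arc s(u, w)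

end PlaneDrawing

/-- A finite simple graph is a planar triangulated graph if it has a drawing in the plane without
crossings all of whose faces are bounded by triangles. -/
def IsPlanarTriangulated {V : Type*} [Finite V] (G : SimpleGraph V) : Prop :=
  ∃ D : PlaneDrawing G, D.IsTriangulated

/-- A path decomposition: a sequence of bags such that every vertex is in some bag, the bags that
contain a given vertex are consecutive, and both ends of every edge are in a common bag. -/
structure PathDecomposition {V : Type*} (G : SimpleGraph V) where
  length : ℕ
  bag : Fin length → Finset V
  vertex_mem : ∀ v : V, ∃ i, v ∈ bag i
  consecutive : ∀ (v : V) (i j l : Fin length), i ≤ j → j ≤ l → v ∈ bag i → v ∈ bag l → v ∈ bag j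
  edge_mem : ∀ u v : V, G.Adj u v → ∃ i, u ∈ bag i ∧ v ∈ bag i

/-- The width of a path decomposition: the largest size of a bag, minus 1. -/
def PathDecomposition.width {V : Type*} {G : SimpleGraph V} (P : PathDecomposition G) : ℕ :=
  (Finset.univ.sup fun i => (P.bag i).card) - 1

/-- The smallest width of a path decomposition (of a finite graph with at least one vertex). -/
noncomputable def pathwidth {V : Type*} (G : SimpleGraph V) : ℕ :=
  sInf {w | ∃ P : PathDecomposition G, P.width = w}

/-- The `W × H`-grid: `W` columns, `H` rows, and an edge between any two grid points of
distance one. -/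
def gridGraph (W H : ℕ) : SimpleGraph (Fin W × Fin H) :=
  SimpleGraph.boxProd (SimpleGraph.pathGraph W) (SimpleGraph.pathGraph H)

/-- A grid-representation of `G` on the `W × H`-grid: a labelling of the grid points by vertices
of `G` such that every vertex is a label, the grid points with a given label induce a connected
subgraph of the grid, and every edge of `G` is realized by some grid edge. -/
structure GridRepresentation {V : Type*} (G : SimpleGraph V) (W H : ℕ) where
  label : Fin W × Fin H → V
  label_surjective : Function.Surjective label
  connected : ∀ v : V, ((gridGraph W H).induce {p | label p = v}).Connected
  edge : ∀ u v : V, G.Adj u v → ∃ p q, (gridGraph W H).Adj p q ∧ label p = u ∧ label q = v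

/-- The smallest height of a grid in which `G` has a grid-representation. (If there is no
grid-representation at all, this is `0`, so that no positive lower bound holds.) -/
noncomputable def gridMajorHeight {V : Type*} (G : SimpleGraph V) : ℕ :=
  sInf {H | ∃ W : ℕ, Nonempty (GridRepresentation G W H)}

/-- The nested triangles graph with `k` triangles. The vertex `(t, i)` is the `i`-th corner of the
`t`-th triangle; the corners of one triangle are pairwise adjacent, the corner `(t, i)` is adjacent
to the corner `(t + 1, j)` of the next triangle exactly if `j ≤ i`, and there are no other
edges. -/
def nestedTriangles (k : ℕ) : SimpleGraph (Fin k × Fin 3) :=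
  SimpleGraph.fromRel fun p q =>
    p.1 = q.1 ∨ ((p.1 : ℕ) + 1 = (q.1 : ℕ) ∧ q.2 ≤ p.2)

/-! Listing the vertices triangle by triangle turns the graph into the cube of a path: two vertices
are adjacent exactly if their positions differ by 1, 2 or 3 (`nestedTriangles_adj_iff`). Windows of
four consecutive positions then form a path decomposition of width 3, and the first four vertices
form a clique, so no width is smaller.

For the drawing, start with a triangle and put each new point at the centroid of its three
predecessors. Centroids commute with affine maps, so the points are the orbit of one affine map
`stackMap`, and every claim about stage `m` is the image of a claim about the standard triangle. The
triangles on three consecutive points are nested, and a segment that starts at point `a` meets the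
triangle of the later points only in its other end (`stackSegment_inter_stackTriangle`). This yields
both the absence of crossings and the list of faces.

For the height, fix a grid point `p` labelled by a vertex of the first triangle and a point `q`
labelled by a vertex of the last one. A triangle `t` strictly between them is joined to `p` through
smaller triangles and to `q` through larger ones. As the grid is planar, the closed walk formed by
`t` winds around exactly one of `p` and `q`; otherwise `p`, `q` and the three corners would behave
like a planar `K₅`. Instead of the Jordan curve theorem, a parity count of crossings is used
(`crossBelow_add_of_disjoint`, `crossBelow_triangle_separates`). A triangle that winds around a
point has labels below and above it in its column, and different triangles use different cells. So
`α` triangles around `p` and `β` around `q` satisfy `2α < H`, `2β < H` and `α + β ≥ k - 2`, whence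
`k ≤ H + 1`.

The infimum of the empty set is `0`, so the bound on `gridMajorHeight` also needs some
representation to exist; concentric rectangles provide one (`ringRepresentation`). -/

/-! ### The graph as the cube of a path -/

/-- The position of a vertex of the nested triangles graph when the triangles are listed one after
the other. The graph is the cube of the path given by this linear order. -/
def linearIndex {k : ℕ} (v : Fin k × Fin 3) : ℕ := 3 * v.1 + v.2

theorem linearIndex_injective {k : ℕ} :
    Function.Injective (linearIndex : Fin k × Fin 3 → ℕ) := by
  rintro ⟨a, i⟩ ⟨b, j⟩ h
  simp only [linearIndex] at h
  ext <;> simp only <;> omega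

theorem linearIndex_lt {k : ℕ} (v : Fin k × Fin 3) : linearIndex v < 3 * k := by
  have h1 := v.1.isLt
  have h2 := v.2.isLt
  simp only [linearIndex]
  omega

theorem exists_linearIndex_eq {k m : ℕ} (hm : m < 3 * k) :
    ∃ v : Fin k × Fin 3, linearIndex v = m :=
  ⟨(⟨m / 3, by omega⟩, ⟨m % 3, by omega⟩), by simp only [linearIndex]; omega⟩

/-- For consecutive triangles the positions differ by `3 + j - i`, which is at most 3 exactly if `j
≤ i`. -/
theorem nestedTriangles_adj_iff {k : ℕ} (u v : Fin k × Fin 3) :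
    (nestedTriangles k).Adj u v ↔ linearIndex u ≠ linearIndex v ∧
      linearIndex u ≤ linearIndex v + 3 ∧ linearIndex v ≤ linearIndex u + 3 := by
  obtain ⟨a, i⟩ := u
  obtain ⟨b, j⟩ := v
  rw [linearIndex_injective.ne_iff]
  simp only [nestedTriangles, SimpleGraph.fromRel_adj, linearIndex, Fin.le_def, Fin.ext_iff]
  refine and_congr_right fun _ => ?_
  omega

/-! ### The pathwidth -/

/-- Helly property of intervals: among the clique vertices take the one whose first bag comes last.
Every other clique vertex has already appeared by then and still shares a bag with it then or later,
so by consecutiveness that first bag contains the whole clique. -/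
theorem PathDecomposition.three_le_width_of_clique {V : Type*} {G : SimpleGraph V}
    (P : PathDecomposition G) {s : Finset V} (hs : s.card = 4)
    (hadj : ∀ u ∈ s, ∀ v ∈ s, u ≠ v → G.Adj u v) : 3 ≤ P.width := by
  classical
  have hne : ∀ v : V, (Finset.univ.filter fun i => v ∈ P.bag i).Nonempty := fun v => by
    obtain ⟨i, hi⟩ := P.vertex_mem v
    exact ⟨i, by simpa using hi⟩
  have hfirst : ∀ v : V, ∃ i, v ∈ P.bag i ∧ ∀ j, v ∈ P.bag j → i ≤ j := fun v =>
    ⟨_, (Finset.mem_filter.mp (Finset.min'_mem _ (hne v))).2,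
      fun j hj => Finset.min'_le _ _ (by simpa using hj)⟩
  choose first hmem hmin using hfirst
  obtain ⟨w, hw, hmax⟩ := Finset.exists_max_image s first (Finset.card_pos.mp (by omega))
  have hsub : s ⊆ P.bag (first w) := by
    intro u hu
    by_cases huw : u = w
    · exact huw ▸ hmem w
    · obtain ⟨j, hj, hj'⟩ := P.edge_mem u w (hadj u hu w hw huw)
      exact P.consecutive u _ _ _ (hmax u hu) (hmin w j hj') (hmem u) hj
  have h4 := Finset.card_le_card hsub
  have hle := Finset.le_sup (f := fun i => (P.bag i).card) (Finset.mem_univ (first w))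
  unfold PathDecomposition.width
  omega

/-- The path decomposition of the nested triangles graph into bags of four consecutive vertices. -/
def nestedTrianglesPathDecomposition (k : ℕ) (hk : 2 ≤ k) :
    PathDecomposition (nestedTriangles k) where
  length := 3 * k - 3
  bag i := Finset.univ.filter fun v => (i : ℕ) ≤ linearIndex v ∧ linearIndex v ≤ i + 3
  vertex_mem v := by
    have := linearIndex_lt v
    -- The last window starts at `3 * k - 4`; the last three vertices are not the start of any
    -- window.
    refine ⟨⟨min (linearIndex v) (3 * k - 4), by omega⟩, ?_⟩
    simp only [Finset.mem_filter, Finset.mem_univ, true_and]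
    omega
  consecutive v i j l hij hjl hi hl := by
    simp only [Finset.mem_filter, Finset.mem_univ, true_and, Fin.le_def] at *
    omega
  edge_mem u v h := by
    have hu := linearIndex_lt u
    have hv := linearIndex_lt v
    rw [nestedTriangles_adj_iff] at h
    refine ⟨⟨min (min (linearIndex u) (linearIndex v)) (3 * k - 4), by omega⟩, ?_⟩
    simp only [Finset.mem_filter, Finset.mem_univ, true_and]
    omega

theorem nestedTrianglesPathDecomposition_width_le (k : ℕ) (hk : 2 ≤ k) :
    (nestedTrianglesPathDecomposition k hk).width ≤ 3 := by
  unfold PathDecomposition.width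
  have : (Finset.univ.sup fun i => ((nestedTrianglesPathDecomposition k hk).bag i).card) ≤ 4 := by
    refine Finset.sup_le fun i _ => ?_
    calc _ = (((nestedTrianglesPathDecomposition k hk).bag i).image linearIndex).card :=
          (Finset.card_image_of_injective _ linearIndex_injective).symm
      _ ≤ (Finset.Icc (i : ℕ) (i + 3)).card := by
          refine Finset.card_le_card fun m hm => ?_
          obtain ⟨v, hv, rfl⟩ := Finset.mem_image.mp hm
          exact Finset.mem_Icc.mpr (Finset.mem_filter.mp hv).2
      _ = 4 := by simp only [Nat.card_Icc]; omega
  omega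

theorem pathwidth_nestedTriangles (k : ℕ) (hk : 2 ≤ k) : pathwidth (nestedTriangles k) = 3 := by
  have hlow : ∀ P : PathDecomposition (nestedTriangles k), 3 ≤ P.width := by
    intro P
    refine P.three_le_width_of_clique (s := Finset.univ.filter fun v => linearIndex v < 4) ?_ ?_
    · rw [← Finset.card_image_of_injective _ linearIndex_injective]
      convert Finset.card_range 4
      ext m
      simp only [Finset.mem_image, Finset.mem_filter, Finset.mem_univ, true_and, Finset.mem_range]
      refine ⟨?_, fun hm => ?_⟩
      · rintro ⟨v, hv, rfl⟩
        exact hv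
      · obtain ⟨v, rfl⟩ := exists_linearIndex_eq (k := k) (m := m) (by omega)
        exact ⟨v, hm, rfl⟩
    · intro u hu v hv huv
      simp only [Finset.mem_filter, Finset.mem_univ, true_and] at hu hv
      rw [nestedTriangles_adj_iff]
      exact ⟨linearIndex_injective.ne huv, by omega, by omega⟩
  have hmem : 3 ∈ {w | ∃ P : PathDecomposition (nestedTriangles k), P.width = w} :=
    ⟨_, le_antisymm (nestedTrianglesPathDecomposition_width_le k hk) (hlow _)⟩
  refine le_antisymm (Nat.sInf_le hmem) (le_csInf ⟨3, hmem⟩ ?_)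
  rintro w ⟨P, rfl⟩
  exact hlow P

/-! ### Triangles in the plane -/

/-- The affine automorphism of the plane that maps `(0, 0)`, `(1, 0)`, `(0, 1)` to `o`, `o + u`,
`o + v`. -/
noncomputable def affineFrame (o u v : ℝ × ℝ) (h : u.1 * v.2 - u.2 * v.1 ≠ 0) :
    (ℝ × ℝ) ≃ᵃ[ℝ] (ℝ × ℝ) :=
  (LinearEquiv.ofInjectiveEndo
    ((LinearMap.fst ℝ ℝ ℝ).smulRight u + (LinearMap.snd ℝ ℝ ℝ).smulRight v)
    (by
      rw [injective_iff_map_eq_zero]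
      rintro ⟨a, b⟩ hab
      simp only [LinearMap.add_apply, LinearMap.smulRight_apply, LinearMap.fst_apply,
        LinearMap.snd_apply, Prod.ext_iff, Prod.fst_add, Prod.snd_add, Prod.smul_fst,
        Prod.smul_snd, smul_eq_mul, Prod.fst_zero, Prod.snd_zero] at hab
      obtain ⟨h1, h2⟩ := hab
      -- Cramer's rule.
      have ha : a * (u.1 * v.2 - u.2 * v.1) = 0 := by linear_combination v.2 * h1 - v.1 * h2
      have hb : b * (u.1 * v.2 - u.2 * v.1) = 0 := by linear_combination u.1 * h2 - u.2 * h1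
      rw [Prod.mk_eq_zero]
      exact ⟨(mul_eq_zero.mp ha).resolve_right h,
        (mul_eq_zero.mp hb).resolve_right h⟩)).toAffineEquiv.trans (AffineEquiv.constVAdd ℝ _ o)

theorem affineFrame_apply {o u v : ℝ × ℝ} (h : u.1 * v.2 - u.2 * v.1 ≠ 0) (x : ℝ × ℝ) :
    affineFrame o u v h x = (o.1 + x.1 * u.1 + x.2 * v.1, o.2 + x.1 * u.2 + x.2 * v.2) := by
  simp [affineFrame, Prod.ext_iff, add_assoc]

/-- The closed triangle with the corners `(0, 0)`, `(1, 0)`, `(0, 1)`. -/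
def closedTriangle : Set (ℝ × ℝ) := {x | 0 ≤ x.1 ∧ 0 ≤ x.2 ∧ x.1 + x.2 ≤ 1}

/-- The open triangle with the corners `(0, 0)`, `(1, 0)`, `(0, 1)`. -/
def openTriangle : Set (ℝ × ℝ) := {x | 0 < x.1 ∧ 0 < x.2 ∧ x.1 + x.2 < 1}

theorem mem_closedTriangle {x : ℝ × ℝ} :
    x ∈ closedTriangle ↔ 0 ≤ x.1 ∧ 0 ≤ x.2 ∧ x.1 + x.2 ≤ 1 := Iff.rfl

theorem mem_openTriangle {x : ℝ × ℝ} :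
    x ∈ openTriangle ↔ 0 < x.1 ∧ 0 < x.2 ∧ x.1 + x.2 < 1 := Iff.rfl

theorem isLinearMap_fst_add_snd : IsLinearMap ℝ fun x : ℝ × ℝ => x.1 + x.2 :=
  (LinearMap.fst ℝ ℝ ℝ + LinearMap.snd ℝ ℝ ℝ).isLinear

theorem convex_closedTriangle : Convex ℝ closedTriangle :=
  (convex_halfSpace_ge (LinearMap.fst ℝ ℝ ℝ).isLinear 0).inter
    ((convex_halfSpace_ge (LinearMap.snd ℝ ℝ ℝ).isLinear 0).inter
      (convex_halfSpace_le isLinearMap_fst_add_snd 1))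

theorem convex_openTriangle : Convex ℝ openTriangle :=
  (convex_halfSpace_gt (LinearMap.fst ℝ ℝ ℝ).isLinear 0).inter
    ((convex_halfSpace_gt (LinearMap.snd ℝ ℝ ℝ).isLinear 0).inter
      (convex_halfSpace_lt isLinearMap_fst_add_snd 1))

theorem isOpen_openTriangle : IsOpen openTriangle :=
  (isOpen_lt continuous_const continuous_fst).inter
    ((isOpen_lt continuous_const continuous_snd).inter
      (isOpen_lt (continuous_fst.add continuous_snd) continuous_const))

theorem isClosed_closedTriangle : IsClosed closedTriangle :=
  (isClosed_le continuous_const continuous_fst).inter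
    ((isClosed_le continuous_const continuous_snd).inter
      (isClosed_le (continuous_fst.add continuous_snd) continuous_const))

theorem openTriangle_subset_closedTriangle : openTriangle ⊆ closedTriangle := fun _ hx =>
  ⟨hx.1.le, hx.2.1.le, hx.2.2.le⟩

theorem closure_openTriangle : closure openTriangle = closedTriangle := by
  refine Set.Subset.antisymm
    (closure_minimal openTriangle_subset_closedTriangle isClosed_closedTriangle) fun x hx => ?_
  -- Moving from any point of the closed triangle towards the centroid enters the open triangle at
  -- once.
  have hsub : openSegment ℝ ((1 / 3, 1 / 3) : ℝ × ℝ) x ⊆ openTriangle := by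
    rintro y ⟨a, b, ha, hb, hab, rfl⟩
    rw [mem_closedTriangle] at hx
    simp only [mem_openTriangle, Prod.fst_add, Prod.snd_add, Prod.smul_fst, Prod.smul_snd,
      smul_eq_mul]
    have h1 := mul_nonneg hb.le hx.1
    have h2 := mul_nonneg hb.le hx.2.1
    have h3 := mul_le_mul_of_nonneg_left hx.2.2 hb.le
    exact ⟨by linarith, by linarith, by linarith⟩
  exact closure_mono hsub (segment_subset_closure_openSegment (right_mem_segment ℝ _ _))

theorem interior_closedTriangle : interior closedTriangle = openTriangle := by
  have hint : interior openTriangle = openTriangle := isOpen_openTriangle.interior_eq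
  rw [← closure_openTriangle, convex_openTriangle.interior_closure_eq_interior_of_nonempty_interior,
    hint]
  rw [hint]
  exact ⟨(1 / 3, 1 / 3), by rw [mem_openTriangle]; norm_num⟩

theorem mem_segment_zero_iff {x p : ℝ × ℝ} :
    x ∈ segment ℝ (0, 0) p ↔ ∃ θ : ℝ, 0 ≤ θ ∧ θ ≤ 1 ∧ x = (θ * p.1, θ * p.2) := by
  rw [segment_eq_image, Set.mem_image]
  constructor
  · rintro ⟨θ, hθ, rfl⟩
    exact ⟨θ, hθ.1, hθ.2, by simp [Prod.ext_iff]⟩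
  · rintro ⟨θ, h0, h1, rfl⟩
    exact ⟨θ, ⟨h0, h1⟩, by simp [Prod.ext_iff]⟩

theorem closedTriangle_diff_openTriangle : closedTriangle \ openTriangle =
    segment ℝ (0, 0) (1, 0) ∪ segment ℝ (1, 0) (0, 1) ∪ segment ℝ (0, 0) (0, 1) := by
  refine Set.Subset.antisymm ?_ ?_
  · rintro ⟨a, b⟩ ⟨hx, hx'⟩
    rw [mem_closedTriangle] at hx
    rw [mem_openTriangle] at hx'
    simp only at hx hx'
    by_cases hb : b = 0
    · exact .inl (.inl (mem_segment_zero_iff.mpr ⟨a, hx.1, by linarith, by simp [hb]⟩))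
    by_cases ha : a = 0
    · exact .inr (mem_segment_zero_iff.mpr ⟨b, hx.2.1, by linarith, by simp [ha]⟩)
    · have h1 : a + b = 1 := le_antisymm hx.2.2 <| le_of_not_gt fun h =>
        hx' ⟨lt_of_le_of_ne hx.1 (Ne.symm ha), lt_of_le_of_ne hx.2.1 (Ne.symm hb), h⟩
      exact .inl (.inr ⟨a, b, hx.1, hx.2.1, h1, by simp⟩)
  · refine Set.union_subset (Set.union_subset ?_ ?_) ?_ <;> intro x hx
    · obtain ⟨θ, h0, h1, rfl⟩ := mem_segment_zero_iff.mp hx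
      simp [mem_closedTriangle, mem_openTriangle, h0, h1]
    · obtain ⟨a, b, ha, hb, hab, rfl⟩ := hx
      simp [mem_closedTriangle, mem_openTriangle, ha, hb, hab]
    · obtain ⟨θ, h0, h1, rfl⟩ := mem_segment_zero_iff.mp hx
      simp [mem_closedTriangle, mem_openTriangle, h0, h1]

theorem affineEquiv_image_segment (e : (ℝ × ℝ) ≃ᵃ[ℝ] (ℝ × ℝ)) (a b : ℝ × ℝ) :
    e '' segment ℝ a b = segment ℝ (e a) (e b) :=
  image_segment ℝ e.toAffineMap a b

theorem frontier_image_openTriangle (e : (ℝ × ℝ) ≃ᵃ[ℝ] (ℝ × ℝ)) :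
    frontier (e '' openTriangle) = segment ℝ (e (0, 0)) (e (1, 0)) ∪
      segment ℝ (e (1, 0)) (e (0, 1)) ∪ segment ℝ (e (0, 0)) (e (0, 1)) := by
  have h : e '' frontier openTriangle = frontier (e '' openTriangle) :=
    (AffineEquiv.toContinuousAffineEquiv e).toHomeomorph.image_frontier openTriangle
  rw [← h, isOpen_openTriangle.frontier_eq, closure_openTriangle, closedTriangle_diff_openTriangle,
    Set.image_union, Set.image_union]
  simp only [affineEquiv_image_segment]

theorem frontier_compl_closedTriangle : frontier closedTriangleᶜ =
    segment ℝ (0, 0) (1, 0) ∪ segment ℝ (1, 0) (0, 1) ∪ segment ℝ (0, 0) (0, 1) := by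
  rw [frontier_compl, isClosed_closedTriangle.frontier_eq, interior_closedTriangle,
    closedTriangle_diff_openTriangle]

theorem isPreconnected_compl_closedTriangle : IsPreconnected closedTriangleᶜ := by
  have h1 : IsPreconnected {x : ℝ × ℝ | x.1 < 0} :=
    (convex_halfSpace_lt (LinearMap.fst ℝ ℝ ℝ).isLinear 0).isPreconnected
  have h2 : IsPreconnected {x : ℝ × ℝ | x.2 < 0} :=
    (convex_halfSpace_lt (LinearMap.snd ℝ ℝ ℝ).isLinear 0).isPreconnected
  have h3 : IsPreconnected {x : ℝ × ℝ | 1 < x.1 + x.2} :=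
    (convex_halfSpace_gt isLinearMap_fst_add_snd 1).isPreconnected
  have h12 := h1.union' ⟨((-1, -1) : ℝ × ℝ), by simp, by simp⟩ h2
  have h123 := h12.union' ⟨((-1, 3) : ℝ × ℝ), .inl (by simp), by simp; norm_num⟩ h3
  convert h123 using 1
  ext x
  simp only [Set.mem_compl_iff, mem_closedTriangle, not_and_or, not_le, Set.mem_union,
    Set.mem_ofPred_eq, or_assoc]

theorem isPreconnected_image_openTriangle (e : (ℝ × ℝ) ≃ᵃ[ℝ] (ℝ × ℝ)) :
    IsPreconnected (e '' openTriangle) :=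
  (convex_openTriangle.affine_image e.toAffineMap).isPreconnected

theorem isOpen_image_openTriangle (e : (ℝ × ℝ) ≃ᵃ[ℝ] (ℝ × ℝ)) : IsOpen (e '' openTriangle) :=
  (AffineEquiv.toContinuousAffineEquiv e).toHomeomorph.isOpenMap _ isOpen_openTriangle

/-- The component avoids `S`, hence the frontier of `U`, so it is covered by the disjoint open sets
`U` and the complement of the closure of `U`. Being connected and meeting `U`, it stays in `U`. This
identifies each face once a candidate region is known. -/
theorem connectedComponentIn_compl_eq_of_frontier_subset {X : Type*} [TopologicalSpace X]
    {S U : Set X} {x : X} (hU : IsOpen U) (hconn : IsPreconnected U) (hdisj : Disjoint U S)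
    (hfr : frontier U ⊆ S) (hx : x ∈ U) : connectedComponentIn Sᶜ x = U := by
  have hUS : U ⊆ Sᶜ := hdisj.subset_compl_right
  refine Set.Subset.antisymm ?_ (hconn.subset_connectedComponentIn hx hUS)
  refine isPreconnected_connectedComponentIn.subset_left_of_subset_union hU
    isClosed_closure.isOpen_compl
    (Set.disjoint_compl_right_iff_subset.mpr subset_closure) (fun y hy => ?_)
    ⟨x, mem_connectedComponentIn (hUS hx), hx⟩
  by_contra hn
  rw [Set.mem_union, not_or, Set.mem_compl_iff, not_not] at hn
  refine connectedComponentIn_subset _ _ hy (hfr ?_)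
  rw [hU.frontier_eq]
  exact ⟨hn.2, hn.1⟩

/-! ### The points of the drawing -/

/-- The affine map that shifts the sequence `stackPoint`. -/
noncomputable def stackMap : (ℝ × ℝ) ≃ᵃ[ℝ] (ℝ × ℝ) :=
  affineFrame (1, 0) (-1, 1) (-2 / 3, 1 / 3) (by norm_num)

/-- The sequence of points in the plane that starts with `(0, 0)`, `(1, 0)`, `(0, 1)` and in which
every further point is the centroid of its three predecessors. -/
noncomputable def stackPoint (m : ℕ) : ℝ × ℝ := (stackMap ^ m) (0, 0)

theorem stackMap_apply (x : ℝ × ℝ) :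
    stackMap x = (1 - x.1 - 2 / 3 * x.2, x.1 + 1 / 3 * x.2) := by
  rw [stackMap, affineFrame_apply]
  ext <;> simp only <;> ring

theorem stackMap_pow_add (m j : ℕ) (x : ℝ × ℝ) :
    (stackMap ^ (m + j)) x = (stackMap ^ m) ((stackMap ^ j) x) := by
  rw [pow_add, AffineEquiv.coe_mul, Function.comp_apply]

theorem stackMap_pow_stackPoint (m j : ℕ) :
    (stackMap ^ m) (stackPoint j) = stackPoint (m + j) :=
  (stackMap_pow_add m j _).symm

theorem stackMap_stackPoint (m : ℕ) : stackMap (stackPoint m) = stackPoint (m + 1) := by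
  rw [add_comm, ← stackMap_pow_stackPoint, pow_one]

theorem stackPoint_zero : stackPoint 0 = (0, 0) := rfl

theorem stackPoint_one : stackPoint 1 = (1, 0) := by
  rw [← stackMap_stackPoint, stackPoint_zero, stackMap_apply]; norm_num

theorem stackPoint_two : stackPoint 2 = (0, 1) := by
  rw [← stackMap_stackPoint, stackPoint_one, stackMap_apply]; norm_num

theorem stackPoint_three : stackPoint 3 = (1 / 3, 1 / 3) := by
  rw [← stackMap_stackPoint, stackPoint_two, stackMap_apply]; norm_num

/-- The straight segment between two points of the sequence. -/
noncomputable def stackSegment (a b : ℕ) : Set (ℝ × ℝ) := segment ℝ (stackPoint a) (stackPoint b)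

theorem stackSegment_symm (a b : ℕ) : stackSegment a b = stackSegment b a := segment_symm _ _ _

theorem image_stackSegment (m a b : ℕ) :
    (stackMap ^ m : (ℝ × ℝ) ≃ᵃ[ℝ] (ℝ × ℝ)) '' stackSegment a b =
      stackSegment (m + a) (m + b) := by
  rw [stackSegment, affineEquiv_image_segment, stackMap_pow_stackPoint, stackMap_pow_stackPoint,
    stackSegment]

theorem stackMap_mem_closedTriangle {x : ℝ × ℝ} (hx : x ∈ closedTriangle) :
    stackMap x ∈ closedTriangle := by
  rw [mem_closedTriangle] at hx
  rw [stackMap_apply, mem_closedTriangle]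
  refine ⟨?_, ?_, ?_⟩ <;> simp only <;> linarith

theorem stackMap_mem_openTriangle {x : ℝ × ℝ} (hx : x ∈ openTriangle) :
    stackMap x ∈ openTriangle := by
  rw [mem_openTriangle] at hx
  rw [stackMap_apply, mem_openTriangle]
  refine ⟨?_, ?_, ?_⟩ <;> simp only <;> linarith

/-- The images of the closed triangle: `stackTriangle m` has the corners `m`, `m + 1`, `m + 2`. -/
noncomputable def stackTriangle (m : ℕ) : Set (ℝ × ℝ) :=
  (stackMap ^ m : (ℝ × ℝ) ≃ᵃ[ℝ] (ℝ × ℝ)) '' closedTriangle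

/-- The interior of `stackTriangle m`. -/
noncomputable def stackInterior (m : ℕ) : Set (ℝ × ℝ) :=
  (stackMap ^ m : (ℝ × ℝ) ≃ᵃ[ℝ] (ℝ × ℝ)) '' openTriangle

theorem stackTriangle_zero : stackTriangle 0 = closedTriangle := by
  simp [stackTriangle]

theorem image_stackTriangle (m j : ℕ) :
    (stackMap ^ m : (ℝ × ℝ) ≃ᵃ[ℝ] (ℝ × ℝ)) '' stackTriangle j = stackTriangle (m + j) := by
  rw [stackTriangle, stackTriangle, Set.image_image]
  simp only [stackMap_pow_add]

theorem mem_stackTriangle_one {x : ℝ × ℝ} :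
    x ∈ stackTriangle 1 ↔ ∃ y ∈ closedTriangle, x = (1 - y.1 - 2 / 3 * y.2, y.1 + 1 / 3 * y.2) := by
  simp only [stackTriangle, pow_one, Set.mem_image, stackMap_apply, eq_comm]

theorem stackTriangle_antitone : Antitone stackTriangle := by
  refine antitone_nat_of_succ_le fun m => ?_
  rw [← image_stackTriangle m 1, stackTriangle]
  refine Set.image_mono ?_
  rintro _ ⟨x, hx, rfl⟩
  rw [pow_one]
  exact stackMap_mem_closedTriangle hx

theorem stackInterior_antitone : Antitone stackInterior := by
  refine antitone_nat_of_succ_le fun m => ?_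
  rintro _ ⟨x, hx, rfl⟩
  exact ⟨stackMap x, stackMap_mem_openTriangle hx, by rw [stackMap_pow_add, pow_one]⟩

theorem stackPoint_mem_stackTriangle {j m : ℕ} (h : j ≤ m) : stackPoint m ∈ stackTriangle j := by
  refine stackTriangle_antitone h ⟨(0, 0), ?_, rfl⟩
  rw [mem_closedTriangle]
  norm_num

theorem stackSegment_subset_stackTriangle {j a b : ℕ} (ha : j ≤ a) (hb : j ≤ b) :
    stackSegment a b ⊆ stackTriangle j :=
  (convex_closedTriangle.affine_image (stackMap ^ j : (ℝ × ℝ) ≃ᵃ[ℝ] (ℝ × ℝ)).toAffineMap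
    ).segment_subset (stackPoint_mem_stackTriangle ha) (stackPoint_mem_stackTriangle hb)

/-- The three segments that join the first point to its later neighbours. -/
theorem mem_stackSegment_zero {x : ℝ × ℝ} {b : ℕ} (hb : 0 < b) (hb' : b ≤ 3)
    (hx : x ∈ stackSegment 0 b) : ∃ θ : ℝ, 0 ≤ θ ∧ θ ≤ 1 ∧
      (b = 1 ∧ x = (θ, 0) ∨ b = 2 ∧ x = (0, θ) ∨ b = 3 ∧ x = (θ / 3, θ / 3)) := by
  obtain ⟨θ, h0, h1, rfl⟩ := mem_segment_zero_iff.mp hx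
  refine ⟨θ, h0, h1, ?_⟩
  interval_cases b
  · simp [stackPoint_one]
  · simp [stackPoint_two]
  · simp [stackPoint_three, div_eq_mul_inv]

/-- The base case of planarity, checked in coordinates; `stackMap ^ a` carries it to every later
stage. -/
theorem stackSegment_zero_inter_stackTriangle_one {x : ℝ × ℝ} {b : ℕ} (hb : 0 < b) (hb' : b ≤ 3)
    (hx : x ∈ stackSegment 0 b) (hx' : x ∈ stackTriangle 1) : x = stackPoint b := by
  obtain ⟨θ, h0, h1, h⟩ := mem_stackSegment_zero hb hb' hx
  obtain ⟨y, hy, hxy⟩ := mem_stackTriangle_one.mp hx'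
  rw [mem_closedTriangle] at hy
  rcases h with ⟨rfl, rfl⟩ | ⟨rfl, rfl⟩ | ⟨rfl, rfl⟩ <;> rw [Prod.mk.injEq] at hxy
  · rw [stackPoint_one, Prod.mk.injEq]
    constructor <;> linarith
  · rw [stackPoint_two, Prod.mk.injEq]
    constructor <;> linarith
  · rw [stackPoint_three, Prod.mk.injEq]
    constructor <;> linarith

/-- All segments between points after `a` lie in `stackTriangle (a + 1)`, so this controls how a
segment meets everything drawn later. -/
theorem stackSegment_inter_stackTriangle {x : ℝ × ℝ} {a b : ℕ} (hab : a < b) (hb : b ≤ a + 3)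
    (hx : x ∈ stackSegment a b) (hx' : x ∈ stackTriangle (a + 1)) : x = stackPoint b := by
  obtain ⟨d, rfl⟩ := Nat.exists_eq_add_of_lt hab
  rw [← image_stackTriangle] at hx'
  rw [← Nat.add_zero a, show a + 0 + d + 1 = a + (d + 1) by omega, ← image_stackSegment] at hx
  obtain ⟨y, hy, rfl⟩ := hx
  obtain ⟨z, hz, hzy⟩ := hx'
  rw [AffineEquiv.injective _ hzy] at hz
  rw [stackSegment_zero_inter_stackTriangle_one (by omega) (by omega) hy hz,
    stackMap_pow_stackPoint]
  rfl

theorem stackPoint_notMem_stackTriangle {j m : ℕ} (h : j < m) :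
    stackPoint j ∉ stackTriangle m := by
  intro hj
  have hj' := stackTriangle_antitone h hj
  rw [Nat.succ_eq_add_one, ← image_stackTriangle, ← Nat.add_zero j,
    ← stackMap_pow_stackPoint] at hj'
  obtain ⟨z, hz, hzy⟩ := hj'
  rw [AffineEquiv.injective _ hzy, mem_stackTriangle_one] at hz
  obtain ⟨y, hy, hxy⟩ := hz
  rw [mem_closedTriangle] at hy
  rw [stackPoint_zero, Prod.mk.injEq] at hxy
  linarith

theorem stackPoint_injective : Function.Injective stackPoint := by
  intro a b h
  by_contra hne
  rcases Nat.lt_or_gt_of_ne hne with hab | hab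
  · exact stackPoint_notMem_stackTriangle hab (h ▸ stackPoint_mem_stackTriangle le_rfl)
  · exact stackPoint_notMem_stackTriangle hab (h ▸ stackPoint_mem_stackTriangle le_rfl)

theorem stackPoint_mem_stackSegment {a b m : ℕ} (hab : a < b) (hb : b ≤ a + 3)
    (h : stackPoint m ∈ stackSegment a b) : m = a ∨ m = b := by
  rcases lt_trichotomy m a with hm | hm | hm
  · exact absurd (stackSegment_subset_stackTriangle le_rfl hab.le h)
      (stackPoint_notMem_stackTriangle hm)
  · exact .inl hm
  · exact .inr (stackPoint_injective
      (stackSegment_inter_stackTriangle hab hb h (stackPoint_mem_stackTriangle hm)))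

theorem stackSegment_inter_same {x : ℝ × ℝ} {a b c : ℕ} (hab : a < b) (hb : b ≤ a + 3)
    (hac : a < c) (hc : c ≤ a + 3) (hbc : b ≠ c) (hx : x ∈ stackSegment a b)
    (hx' : x ∈ stackSegment a c) : x = stackPoint a := by
  obtain ⟨b, rfl⟩ := Nat.exists_eq_add_of_lt hab
  obtain ⟨c, rfl⟩ := Nat.exists_eq_add_of_lt hac
  have key : ∀ d, stackSegment a (a + d + 1) =
      (stackMap ^ a : (ℝ × ℝ) ≃ᵃ[ℝ] (ℝ × ℝ)) '' stackSegment 0 (d + 1) := fun d => by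
    rw [image_stackSegment]
    rfl
  rw [key] at hx hx'
  obtain ⟨y, hy, rfl⟩ := hx
  obtain ⟨z, hz, hzy⟩ := hx'
  rw [AffineEquiv.injective _ hzy] at hz
  suffices h : y = stackPoint 0 by rw [h, stackMap_pow_stackPoint, Nat.add_zero]
  obtain ⟨θ, h0, h1, h⟩ := mem_stackSegment_zero (by omega) (by omega) hy
  obtain ⟨η, h0', h1', h'⟩ := mem_stackSegment_zero (by omega) (by omega) hz
  rw [stackPoint_zero]
  rcases h with ⟨e, rfl⟩ | ⟨e, rfl⟩ | ⟨e, rfl⟩ <;>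
    rcases h' with ⟨e', h'⟩ | ⟨e', h'⟩ | ⟨e', h'⟩ <;>
    first
      | (exfalso; omega)
      | (rw [Prod.mk.injEq] at h' ⊢; constructor <;> linarith)

/-- Compare the smaller ends. If they differ, the later segment lies in the nested triangle that the
earlier one only touches at its larger end; if they agree, the two segments leave the common point
in different directions. -/
theorem stackSegment_inter {x : ℝ × ℝ} {a b c d : ℕ} (hab : a < b) (hb : b ≤ a + 3) (hcd : c < d)
    (hd : d ≤ c + 3) (hne : ¬(a = c ∧ b = d)) (hx : x ∈ stackSegment a b)
    (hx' : x ∈ stackSegment c d) : ∃ m, (m = a ∨ m = b) ∧ (m = c ∨ m = d) ∧ x = stackPoint m := by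
  rcases lt_trichotomy a c with h | rfl | h
  · have := stackSegment_inter_stackTriangle hab hb hx
      (stackSegment_subset_stackTriangle h (by omega) hx')
    exact ⟨b, .inr rfl, stackPoint_mem_stackSegment hcd hd (this ▸ hx'), this⟩
  · exact ⟨a, .inl rfl, .inl rfl,
      stackSegment_inter_same hab hb hcd hd (fun h => hne ⟨rfl, h⟩) hx hx'⟩
  · have := stackSegment_inter_stackTriangle hcd hd hx'
      (stackSegment_subset_stackTriangle h (by omega) hx)
    exact ⟨d, stackPoint_mem_stackSegment hab hb (this ▸ hx), .inr rfl, this⟩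

/-! ### The faces of the drawing -/

/-- The only candidate for a common point is the end `b`, and that is a corner of `stackTriangle (a
+ 1)`, not an interior point. -/
theorem disjoint_stackInterior_stackSegment_of_lt {a b m : ℕ} (hab : a < b) (hb : b ≤ a + 3)
    (ham : a < m) : Disjoint (stackInterior m) (stackSegment a b) := by
  rw [Set.disjoint_left]
  intro x hx hx'
  obtain ⟨y, hy, rfl⟩ := stackInterior_antitone (Nat.succ_le_of_lt ham) hx
  have h := stackSegment_inter_stackTriangle hab hb hx'
    ⟨y, openTriangle_subset_closedTriangle hy, rfl⟩
  obtain ⟨d, rfl⟩ := Nat.exists_eq_add_of_lt hab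
  rw [show a + d + 1 = a + 1 + d by omega, ← stackMap_pow_stackPoint, Nat.succ_eq_add_one] at h
  have hd := AffineEquiv.injective _ h
  have : d ≤ 2 := by omega
  rw [mem_openTriangle] at hy
  interval_cases d
  · rw [stackPoint_zero, Prod.ext_iff] at hd
    simp only at hd
    linarith
  · rw [stackPoint_one, Prod.ext_iff] at hd
    simp only at hd
    linarith
  · rw [stackPoint_two, Prod.ext_iff] at hd
    simp only at hd
    linarith

theorem disjoint_stackInterior_stackSegment {a b m : ℕ} (hab : a < b) (hb : b ≤ a + 3)
    (hbm : b ≤ m + 2) : Disjoint (stackInterior m) (stackSegment a b) := by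
  rcases Nat.lt_or_ge a m with h | h
  · exact disjoint_stackInterior_stackSegment_of_lt hab hb h
  · obtain ⟨i, rfl⟩ := Nat.exists_eq_add_of_le h
    obtain ⟨j, rfl⟩ := Nat.exists_eq_add_of_le (h.trans hab.le)
    rw [← image_stackSegment, stackInterior,
      Set.disjoint_image_iff (AffineEquiv.injective _)]
    have hj : j ≤ 2 := by omega
    have hij : i < j := by omega
    have hsub : stackSegment i j ⊆ closedTriangle \ openTriangle := by
      rw [closedTriangle_diff_openTriangle, ← stackPoint_zero, ← stackPoint_one, ← stackPoint_two]
      interval_cases j <;> interval_cases i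
      · exact fun x hx => .inl (.inl hx)
      · exact fun x hx => .inr hx
      · exact fun x hx => .inl (.inr hx)
    exact Set.disjoint_left.mpr fun x hx hx' => (hsub hx').2 hx

/-- The affine map onto the triangle with the corners `0`, `1`, `3`. -/
noncomputable def lowerFrame : (ℝ × ℝ) ≃ᵃ[ℝ] (ℝ × ℝ) :=
  affineFrame (0, 0) (1, 0) (1 / 3, 1 / 3) (by norm_num)

/-- The affine map onto the triangle with the corners `0`, `2`, `3`. -/
noncomputable def upperFrame : (ℝ × ℝ) ≃ᵃ[ℝ] (ℝ × ℝ) :=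
  affineFrame (0, 0) (0, 1) (1 / 3, 1 / 3) (by norm_num)

theorem lowerFrame_apply (x : ℝ × ℝ) : lowerFrame x = (x.1 + 1 / 3 * x.2, 1 / 3 * x.2) := by
  rw [lowerFrame, affineFrame_apply]
  ext <;> simp only <;> ring

theorem upperFrame_apply (x : ℝ × ℝ) : upperFrame x = (1 / 3 * x.2, x.1 + 1 / 3 * x.2) := by
  rw [upperFrame, affineFrame_apply]
  ext <;> simp only <;> ring

/-- A triangle between `stackTriangle m` and `stackTriangle (m + 1)` is not met by any segment,
given that this holds for the segments that start at the point `m`. -/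
theorem disjoint_image_stackSegment {e : (ℝ × ℝ) ≃ᵃ[ℝ] (ℝ × ℝ)}
    (hint : e '' openTriangle ⊆ openTriangle) (hnext : Disjoint (e '' openTriangle) (stackTriangle 1))
    (hseg : ∀ b, 0 < b → b ≤ 3 → Disjoint (e '' openTriangle) (stackSegment 0 b)) {a b : ℕ}
    (hab : a < b) (hb : b ≤ a + 3) (m : ℕ) :
    Disjoint ((stackMap ^ m * e) '' openTriangle) (stackSegment a b) := by
  rw [AffineEquiv.coe_mul, Set.image_comp]
  -- Segments that start earlier avoid `stackInterior m`, those that start at `m` are covered by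
  -- `hseg`, and those that start later lie in `stackTriangle (m + 1)`.
  rcases lt_trichotomy a m with h | rfl | h
  · exact (disjoint_stackInterior_stackSegment_of_lt hab hb h).mono_left (Set.image_mono hint)
  · obtain ⟨d, rfl⟩ := Nat.exists_eq_add_of_lt hab
    have key : stackSegment a (a + d + 1) =
        (stackMap ^ a : (ℝ × ℝ) ≃ᵃ[ℝ] (ℝ × ℝ)) '' stackSegment 0 (d + 1) := by
      rw [image_stackSegment]
      rfl
    rw [key, Set.disjoint_image_iff (AffineEquiv.injective _)]
    exact hseg _ (by omega) (by omega)
  · refine Disjoint.mono_right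
      (stackSegment_subset_stackTriangle (j := m + 1) h (by omega)) ?_
    rw [← image_stackTriangle, Set.disjoint_image_iff (AffineEquiv.injective _)]
    exact hnext

theorem disjoint_lower_stackSegment {a b : ℕ} (hab : a < b) (hb : b ≤ a + 3) (m : ℕ) :
    Disjoint ((stackMap ^ m * lowerFrame) '' openTriangle) (stackSegment a b) := by
  refine disjoint_image_stackSegment ?_ ?_ ?_ hab hb m
  · rintro _ ⟨x, hx, rfl⟩
    rw [mem_openTriangle] at hx
    rw [lowerFrame_apply, mem_openTriangle]
    refine ⟨?_, ?_, ?_⟩ <;> simp only <;> linarith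
  · rw [Set.disjoint_left]
    rintro _ ⟨x, hx, rfl⟩ h
    obtain ⟨y, hy, hxy⟩ := mem_stackTriangle_one.mp h
    rw [mem_openTriangle] at hx
    rw [mem_closedTriangle] at hy
    rw [lowerFrame_apply, Prod.mk.injEq] at hxy
    linarith
  · intro b h1 h3
    rw [Set.disjoint_left]
    rintro _ ⟨x, hx, rfl⟩ h
    rw [mem_openTriangle] at hx
    obtain ⟨θ, h0, h1, ⟨-, h⟩ | ⟨-, h⟩ | ⟨-, h⟩⟩ := mem_stackSegment_zero h1 h3 h <;>
      rw [lowerFrame_apply, Prod.mk.injEq] at h <;> linarith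

theorem disjoint_upper_stackSegment {a b : ℕ} (hab : a < b) (hb : b ≤ a + 3) (m : ℕ) :
    Disjoint ((stackMap ^ m * upperFrame) '' openTriangle) (stackSegment a b) := by
  refine disjoint_image_stackSegment ?_ ?_ ?_ hab hb m
  · rintro _ ⟨x, hx, rfl⟩
    rw [mem_openTriangle] at hx
    rw [upperFrame_apply, mem_openTriangle]
    refine ⟨?_, ?_, ?_⟩ <;> simp only <;> linarith
  · rw [Set.disjoint_left]
    rintro _ ⟨x, hx, rfl⟩ h
    obtain ⟨y, hy, hxy⟩ := mem_stackTriangle_one.mp h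
    rw [mem_openTriangle] at hx
    rw [mem_closedTriangle] at hy
    rw [upperFrame_apply, Prod.mk.injEq] at hxy
    linarith
  · intro b h1 h3
    rw [Set.disjoint_left]
    rintro _ ⟨x, hx, rfl⟩ h
    rw [mem_openTriangle] at hx
    obtain ⟨θ, h0, h1, ⟨-, h⟩ | ⟨-, h⟩ | ⟨-, h⟩⟩ := mem_stackSegment_zero h1 h3 h <;>
      rw [upperFrame_apply, Prod.mk.injEq] at h <;> linarith

/-- The centroid splits the triangle into three parts, separated by the lines `a = b`, `a + 2 * b =
1` and `2 * a + b = 1`. The third part keeps its boundary since it is subdivided further. -/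
theorem closedTriangle_cover {x : ℝ × ℝ} (hx : x ∈ closedTriangle)
    (hseg : ∀ b, 0 < b → b ≤ 3 → x ∉ stackSegment 0 b) :
    x ∈ lowerFrame '' openTriangle ∨ x ∈ upperFrame '' openTriangle ∨ x ∈ stackTriangle 1 := by
  obtain ⟨a, b⟩ := x
  rw [mem_closedTriangle] at hx
  simp only at hx
  have hb : 0 < b := lt_of_le_of_ne hx.2.1 fun h => hseg 1 (by omega) (by omega)
    (mem_segment_zero_iff.mpr ⟨a, hx.1, by linarith, by simp [stackPoint_one, ← h]⟩)
  have ha : 0 < a := lt_of_le_of_ne hx.1 fun h => hseg 2 (by omega) (by omega)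
    (mem_segment_zero_iff.mpr ⟨b, hx.2.1, by linarith, by simp [stackPoint_two, ← h]⟩)
  have hne : a = b → 1 < 3 * a := fun h => lt_of_not_ge fun h' => hseg 3 (by omega) (by omega)
    (mem_segment_zero_iff.mpr ⟨3 * a, by linarith, h', by
      rw [stackPoint_three, ← h]
      ext <;> simp only <;> ring⟩)
  have hlow : b < a → a + 2 * b < 1 → (a, b) ∈ lowerFrame '' openTriangle := fun h h' =>
    ⟨(a - b, 3 * b), by rw [mem_openTriangle]; refine ⟨?_, ?_, ?_⟩ <;> simp only <;> linarith,
      by rw [lowerFrame_apply]; ext <;> simp only <;> ring⟩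
  have hupp : a < b → 2 * a + b < 1 → (a, b) ∈ upperFrame '' openTriangle := fun h h' =>
    ⟨(b - a, 3 * a), by rw [mem_openTriangle]; refine ⟨?_, ?_, ?_⟩ <;> simp only <;> linarith,
      by rw [upperFrame_apply]; ext <;> simp only <;> ring⟩
  by_cases h1 : a + 2 * b < 1
  · rcases lt_trichotomy a b with h | h | h
    · exact .inr (.inl (hupp h (by linarith)))
    · linarith [hne h]
    · exact .inl (hlow h h1)
  · by_cases h2 : 2 * a + b < 1
    · exact .inr (.inl (hupp (by linarith) h2))
    -- The witness is the preimage of `(a, b)` under `stackMap`.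
    · refine .inr (.inr (mem_stackTriangle_one.mpr ⟨(a + 2 * b - 1, 3 * (1 - a - b)), ?_, ?_⟩))
      · rw [mem_closedTriangle]
        refine ⟨?_, ?_, ?_⟩ <;> simp only <;> linarith
      · ext <;> simp only <;> ring

theorem stackTriangle_cover {x : ℝ × ℝ} (hx : x ∈ closedTriangle) (m : ℕ)
    (hseg : ∀ a b, a < m → a < b → b ≤ a + 3 → x ∉ stackSegment a b) :
    x ∈ stackTriangle m ∨ ∃ j < m, x ∈ (stackMap ^ j * lowerFrame) '' openTriangle ∨
      x ∈ (stackMap ^ j * upperFrame) '' openTriangle := by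
  induction m with
  | zero => exact .inl (stackTriangle_zero ▸ hx)
  | succ m ih =>
    rcases ih fun a b ha => hseg a b (by omega) with ⟨y, hy, rfl⟩ | ⟨j, hj, h⟩
    · have hy' : ∀ b, 0 < b → b ≤ 3 → y ∉ stackSegment 0 b := fun b hb hb' hyb =>
        hseg m (m + b) (by omega) (by omega) (by omega)
          (image_stackSegment m 0 b ▸ Set.mem_image_of_mem _ hyb)
      rcases closedTriangle_cover hy hy' with h | h | h
      · refine .inr ⟨m, by omega, .inl ?_⟩
        rw [AffineEquiv.coe_mul, Set.image_comp]
        exact Set.mem_image_of_mem _ h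
      · refine .inr ⟨m, by omega, .inr ?_⟩
        rw [AffineEquiv.coe_mul, Set.image_comp]
        exact Set.mem_image_of_mem _ h
      · exact .inl (image_stackTriangle m 1 ▸ Set.mem_image_of_mem _ h)
    · exact .inr ⟨j, by omega, h⟩

theorem mem_stackInterior_of_mem_stackTriangle {x : ℝ × ℝ} {m : ℕ} (hx : x ∈ stackTriangle m)
    (hseg : ∀ a b, a < b → b ≤ m + 2 → b ≤ a + 3 → x ∉ stackSegment a b) :
    x ∈ stackInterior m := by
  obtain ⟨y, hy, rfl⟩ := hx
  refine Set.mem_image_of_mem _ (of_not_not fun hn => ?_)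
  have h : y ∈ closedTriangle \ openTriangle := ⟨hy, hn⟩
  rw [closedTriangle_diff_openTriangle, ← stackPoint_zero, ← stackPoint_one, ← stackPoint_two] at h
  have key : ∀ a b, y ∈ stackSegment a b →
      (stackMap ^ m) y ∈ stackSegment (m + a) (m + b) := fun a b hyab =>
    image_stackSegment m a b ▸ Set.mem_image_of_mem _ hyab
  rcases h with (h | h) | h
  · exact hseg _ _ (by omega) (by omega) (by omega) (key 0 1 h)
  · exact hseg _ _ (by omega) (by omega) (by omega) (key 1 2 h)
  · exact hseg _ _ (by omega) (by omega) (by omega) (key 0 2 h)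

/-- If a set is the union of the segments between points of the sequence that are at most three
steps apart, then the components of its complement are bounded by triangles. -/
theorem frontier_connectedComponentIn_stackSegments {S : Set (ℝ × ℝ)} {n : ℕ} (hn : 3 ≤ n)
    (hS : ∀ x, x ∈ S ↔ ∃ a b, a < b ∧ b ≤ a + 3 ∧ b < n ∧ x ∈ stackSegment a b)
    {x : ℝ × ℝ} (hx : x ∉ S) : ∃ a b c, a < b ∧ b < c ∧ c ≤ a + 3 ∧ c < n ∧
      frontier (connectedComponentIn Sᶜ x) =
        stackSegment a b ∪ stackSegment b c ∪ stackSegment a c := by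
  have key : ∀ (U : Set (ℝ × ℝ)) (a b c : ℕ), a < b → b < c → c ≤ a + 3 → c < n → IsOpen U →
      IsPreconnected U → (∀ i j, i < j → j ≤ i + 3 → j < n → Disjoint U (stackSegment i j)) →
      frontier U = stackSegment a b ∪ stackSegment b c ∪ stackSegment a c → x ∈ U →
      ∃ a b c, a < b ∧ b < c ∧ c ≤ a + 3 ∧ c < n ∧
        frontier (connectedComponentIn Sᶜ x) =
          stackSegment a b ∪ stackSegment b c ∪ stackSegment a c := by
    intro U a b c hab hbc hca hc hU hconn hdisj hfr hxU
    refine ⟨a, b, c, hab, hbc, hca, hc, ?_⟩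
    rw [connectedComponentIn_compl_eq_of_frontier_subset hU hconn ?_ ?_ hxU, hfr]
    · rw [Set.disjoint_left]
      intro y hy hyS
      obtain ⟨i, j, h1, h2, h3, h4⟩ := (hS y).mp hyS
      exact Set.disjoint_left.mp (hdisj i j h1 h2 h3) hy h4
    · rw [hfr]
      rintro y ((hy | hy) | hy)
      · exact (hS y).mpr ⟨a, b, hab, by omega, by omega, hy⟩
      · exact (hS y).mpr ⟨b, c, hbc, by omega, by omega, hy⟩
      · exact (hS y).mpr ⟨a, c, by omega, by omega, by omega, hy⟩
  have keyImage : ∀ (e : (ℝ × ℝ) ≃ᵃ[ℝ] (ℝ × ℝ)) (a b c : ℕ), a < b → b < c → c ≤ a + 3 → c < n →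
      e (0, 0) = stackPoint a → e (1, 0) = stackPoint b → e (0, 1) = stackPoint c →
      (∀ i j, i < j → j ≤ i + 3 → j < n → Disjoint (e '' openTriangle) (stackSegment i j)) →
      x ∈ e '' openTriangle → ∃ a b c, a < b ∧ b < c ∧ c ≤ a + 3 ∧ c < n ∧
        frontier (connectedComponentIn Sᶜ x) =
          stackSegment a b ∪ stackSegment b c ∪ stackSegment a c := by
    intro e a b c hab hbc hca hc ea eb ec hdisj hxe
    refine key _ a b c hab hbc hca hc (isOpen_image_openTriangle e)
      (isPreconnected_image_openTriangle e) hdisj ?_ hxe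
    rw [frontier_image_openTriangle, ea, eb, ec, stackSegment, stackSegment, stackSegment]
  have hseg : ∀ a b, a < b → b ≤ a + 3 → b < n → x ∉ stackSegment a b := fun a b h1 h2 h3 h =>
    hx ((hS x).mpr ⟨a, b, h1, h2, h3, h⟩)
  -- The faces are the innermost triangle on the last three points, the two triangles cut off at
  -- each stage `j`, and the outer face bounded by the first three points.
  by_cases hxT : x ∈ closedTriangle
  · rcases stackTriangle_cover hxT (n - 3)
      (fun a b h1 h2 h3 => hseg a b h2 h3 (by omega)) with h | ⟨j, hj, h | h⟩
    · refine keyImage (stackMap ^ (n - 3)) (n - 3) (n - 3 + 1) (n - 3 + 2) (by omega) (by omega)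
        (by omega) (by omega) rfl ?_ ?_ (fun a b h1 h2 h3 =>
          disjoint_stackInterior_stackSegment h1 h2 (by omega))
        (mem_stackInterior_of_mem_stackTriangle h fun a b h1 h2 h3 => hseg a b h1 h3 (by omega))
      · rw [← stackPoint_one, stackMap_pow_stackPoint]
      · rw [← stackPoint_two, stackMap_pow_stackPoint]
    · refine keyImage _ j (j + 1) (j + 3) (by omega) (by omega) (by omega) (by omega) ?_ ?_ ?_
        (fun a b h1 h2 _ => disjoint_lower_stackSegment h1 h2 j) h
      · rw [AffineEquiv.coe_mul, Function.comp_apply, lowerFrame_apply]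
        norm_num [stackPoint]
      · rw [AffineEquiv.coe_mul, Function.comp_apply, lowerFrame_apply, ← stackMap_pow_stackPoint,
          stackPoint_one]
        norm_num
      · rw [AffineEquiv.coe_mul, Function.comp_apply, lowerFrame_apply, ← stackMap_pow_stackPoint,
          stackPoint_three]
        norm_num
    · refine keyImage _ j (j + 2) (j + 3) (by omega) (by omega) (by omega) (by omega) ?_ ?_ ?_
        (fun a b h1 h2 _ => disjoint_upper_stackSegment h1 h2 j) h
      · rw [AffineEquiv.coe_mul, Function.comp_apply, upperFrame_apply]
        norm_num [stackPoint]
      · rw [AffineEquiv.coe_mul, Function.comp_apply, upperFrame_apply, ← stackMap_pow_stackPoint,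
          stackPoint_two]
        norm_num
      · rw [AffineEquiv.coe_mul, Function.comp_apply, upperFrame_apply, ← stackMap_pow_stackPoint,
          stackPoint_three]
        norm_num
  · refine key closedTriangleᶜ 0 1 2 (by omega) (by omega) (by omega) (by omega)
      isClosed_closedTriangle.isOpen_compl isPreconnected_compl_closedTriangle ?_ ?_ hxT
    · intro i j hij _ _
      rw [Set.disjoint_compl_left_iff_subset, ← stackTriangle_zero]
      exact stackSegment_subset_stackTriangle (Nat.zero_le _) (Nat.zero_le _)
    · rw [frontier_compl_closedTriangle, ← stackPoint_zero, ← stackPoint_one, ← stackPoint_two,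
        stackSegment, stackSegment, stackSegment]

/-! ### The drawing of the nested triangles graph -/

/-- The straight segment that draws an edge of the nested triangles graph. -/
noncomputable def stackArc {k : ℕ} : Sym2 (Fin k × Fin 3) → Set (ℝ × ℝ) :=
  Sym2.lift ⟨fun u v => stackSegment (linearIndex u) (linearIndex v),
    fun _ _ => stackSegment_symm _ _⟩

theorem nestedTriangles_exists_oriented {k : ℕ} {e : Sym2 (Fin k × Fin 3)}
    (he : e ∈ (nestedTriangles k).edgeSet) : ∃ u v, e = s(u, v) ∧
      linearIndex u < linearIndex v ∧ linearIndex v ≤ linearIndex u + 3 := by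
  induction e with
  | h u v =>
    rw [SimpleGraph.mem_edgeSet, nestedTriangles_adj_iff] at he
    rcases Nat.lt_or_gt_of_ne he.1 with h | h
    · exact ⟨u, v, rfl, h, he.2.2⟩
    · exact ⟨v, u, Sym2.eq_swap, h, he.2.1⟩

/-- The straight-line drawing of the nested triangles graph. -/
noncomputable def nestedTrianglesDrawing (k : ℕ) : PlaneDrawing (nestedTriangles k) where
  point v := stackPoint (linearIndex v)
  point_injective := stackPoint_injective.comp linearIndex_injective
  arc := stackArc
  arc_isArc u v h :=
    ⟨Path.segment _ _, Path.segment_injective_of_ne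
      ((stackPoint_injective.comp linearIndex_injective).ne h.ne), Path.range_segment _ _⟩
  vertex_on_arc e he v hv := by
    obtain ⟨a, b, rfl, hab, hb⟩ := nestedTriangles_exists_oriented he
    rw [Sym2.mem_iff]
    exact (stackPoint_mem_stackSegment hab hb hv).imp (fun h => linearIndex_injective h)
      fun h => linearIndex_injective h
  arc_inter_arc e he e' he' hne x hx := by
    obtain ⟨a, b, rfl, hab, hb⟩ := nestedTriangles_exists_oriented he
    obtain ⟨c, d, rfl, hcd, hd⟩ := nestedTriangles_exists_oriented he'
    obtain ⟨m, hm, hm', rfl⟩ := stackSegment_inter hab hb hcd hd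
      (fun h => hne (by rw [linearIndex_injective h.1, linearIndex_injective h.2])) hx.1 hx.2
    obtain ⟨v, rfl⟩ : ∃ v : Fin k × Fin 3, linearIndex v = m := by
      rcases hm with rfl | rfl
      exacts [⟨a, rfl⟩, ⟨b, rfl⟩]
    exact ⟨v, Sym2.mem_iff.mpr (hm.imp (fun h => linearIndex_injective h)
      fun h => linearIndex_injective h), Sym2.mem_iff.mpr (hm'.imp
        (fun h => linearIndex_injective h) fun h => linearIndex_injective h), rfl⟩

theorem mem_support_nestedTrianglesDrawing {k : ℕ} (x : ℝ × ℝ) :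
    x ∈ (nestedTrianglesDrawing k).support ↔
      ∃ a b, a < b ∧ b ≤ a + 3 ∧ b < 3 * k ∧ x ∈ stackSegment a b := by
  constructor
  · rintro (⟨v, rfl⟩ | hx)
    · have hv := linearIndex_lt v
      by_cases h : linearIndex v = 0
      · exact ⟨linearIndex v, 1, by omega, by omega, by omega, left_mem_segment ℝ _ _⟩
      · exact ⟨linearIndex v - 1, linearIndex v, by omega, by omega, hv, right_mem_segment ℝ _ _⟩
    · rw [Set.mem_iUnion₂] at hx
      obtain ⟨e, he, hx⟩ := hx
      obtain ⟨a, b, rfl, hab, hb⟩ := nestedTriangles_exists_oriented he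
      exact ⟨_, _, hab, hb, linearIndex_lt b, hx⟩
  · rintro ⟨a, b, hab, hb, hbk, hx⟩
    obtain ⟨u, rfl⟩ := exists_linearIndex_eq (hab.trans hbk)
    obtain ⟨v, rfl⟩ := exists_linearIndex_eq hbk
    refine .inr (Set.mem_iUnion₂.mpr ⟨s(u, v), ?_, hx⟩)
    rw [SimpleGraph.mem_edgeSet, nestedTriangles_adj_iff]
    omega

theorem isPlanarTriangulated_nestedTriangles (k : ℕ) (hk : 2 ≤ k) :
    IsPlanarTriangulated (nestedTriangles k) := by
  refine ⟨nestedTrianglesDrawing k, ?_⟩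
  rintro _ ⟨x, hx, rfl⟩
  obtain ⟨a, b, c, hab, hbc, hca, hc, hfr⟩ := frontier_connectedComponentIn_stackSegments
    (n := 3 * k) (by omega) mem_support_nestedTrianglesDrawing hx
  obtain ⟨u, rfl⟩ := exists_linearIndex_eq (hab.trans (hbc.trans hc))
  obtain ⟨v, rfl⟩ := exists_linearIndex_eq (hbc.trans hc)
  obtain ⟨w, rfl⟩ := exists_linearIndex_eq hc
  simp only [nestedTriangles_adj_iff]
  exact ⟨u, v, w, by omega, by omega, by omega, hfr⟩

/-! ### Crossing parities of walks in the grid -/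

/-- Indicator of the event that the grid edge `ab` is horizontal, starts in the column of `v` and
runs below `v`. -/
def edgeBelow {W H : ℕ} (v a b : Fin W × Fin H) : ZMod 2 :=
  if (a.2 : ℕ) = b.2 ∧ (a.2 : ℕ) < v.2 ∧ min (a.1 : ℕ) b.1 = v.1 then 1 else 0

/-- Indicator of the event that the grid edge `ab` is horizontal and starts in the column
of `v`. -/
def edgeColumn {W H : ℕ} (v a b : Fin W × Fin H) : ZMod 2 :=
  if (a.2 : ℕ) = b.2 ∧ min (a.1 : ℕ) b.1 = v.1 then 1 else 0

/-- Indicator of the lexicographic order on grid points. -/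
def lexIndicator {W H : ℕ} (a c : Fin W × Fin H) : ZMod 2 :=
  if (a.1 : ℕ) < c.1 ∨ (a.1 : ℕ) = c.1 ∧ (a.2 : ℕ) < c.2 then 1 else 0

/-- The parity of the number of horizontal edges of a walk that start in the column of `v` and run
below `v`. -/
def crossBelow {W H : ℕ} (v : Fin W × Fin H) :
    ∀ {a b : Fin W × Fin H}, (gridGraph W H).Walk a b → ZMod 2
  | _, _, .nil => 0
  | a, _, .cons (v := b) _ w => edgeBelow v a b + crossBelow v w

/-- The parity of the number of horizontal edges of a walk that start in the column of `v`. -/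
def crossColumn {W H : ℕ} (v : Fin W × Fin H) :
    ∀ {a b : Fin W × Fin H}, (gridGraph W H).Walk a b → ZMod 2
  | _, _, .nil => 0
  | a, _, .cons (v := b) _ w => edgeColumn v a b + crossColumn v w

theorem gridGraph_adj_iff {W H : ℕ} (a b : Fin W × Fin H) :
    (gridGraph W H).Adj a b ↔
      (((a.1 : ℕ) + 1 = b.1 ∨ (b.1 : ℕ) + 1 = a.1) ∧ (a.2 : ℕ) = b.2) ∨
      (((a.2 : ℕ) + 1 = b.2 ∨ (b.2 : ℕ) + 1 = a.2) ∧ (a.1 : ℕ) = b.1) := by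
  simp only [gridGraph, SimpleGraph.boxProd_adj, SimpleGraph.pathGraph_adj, Fin.ext_iff]

theorem edgeBelow_comm {W H : ℕ} (v a b : Fin W × Fin H) : edgeBelow v a b = edgeBelow v b a := by
  unfold edgeBelow
  congr 1
  rw [min_comm, eq_iff_iff]
  constructor <;> rintro ⟨h1, h2, h3⟩ <;> exact ⟨h1.symm, by omega, h3⟩

theorem lexIndicator_add_swap {W H : ℕ} {a c : Fin W × Fin H} (h : a ≠ c) :
    lexIndicator a c + lexIndicator c a = 1 := by
  have h' : ¬((a.1 : ℕ) = c.1 ∧ (a.2 : ℕ) = c.2) := fun hh =>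
    h (Prod.ext (Fin.ext hh.1) (Fin.ext hh.2))
  unfold lexIndicator
  split_ifs <;> first | rfl | omega

/-- The crossing identity for two disjoint grid edges that point right or up. -/
theorem edgeBelow_add_of_oriented {W H : ℕ} {a b c d : Fin W × Fin H}
    (hab : ((a.1 : ℕ) + 1 = b.1 ∧ (a.2 : ℕ) = b.2) ∨ ((a.2 : ℕ) + 1 = b.2 ∧ (a.1 : ℕ) = b.1))
    (hcd : ((c.1 : ℕ) + 1 = d.1 ∧ (c.2 : ℕ) = d.2) ∨ ((c.2 : ℕ) + 1 = d.2 ∧ (c.1 : ℕ) = d.1))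
    (hac : a ≠ c) (had : a ≠ d) (hbc : b ≠ c) (hbd : b ≠ d) :
    edgeBelow a c d + edgeBelow b c d + edgeBelow c a b + edgeBelow d a b =
      lexIndicator a c + lexIndicator a d + lexIndicator b c + lexIndicator b d := by
  obtain ⟨⟨ax, hax⟩, ⟨ay, hay⟩⟩ := a
  obtain ⟨⟨bx, hbx⟩, ⟨bY, hby⟩⟩ := b
  obtain ⟨⟨cx, hcx⟩, ⟨cy, hcy⟩⟩ := c
  obtain ⟨⟨dx, hdx⟩, ⟨dy, hdy⟩⟩ := d
  simp only [ne_eq, Prod.mk.injEq, Fin.mk.injEq, not_and] at *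
  unfold edgeBelow lexIndicator
  simp only
  have hn : ∀ y : ℕ, y ≠ y + 1 := fun y => by omega
  rcases hab with ⟨rfl, rfl⟩ | ⟨rfl, rfl⟩ <;> rcases hcd with ⟨rfl, rfl⟩ | ⟨rfl, rfl⟩ <;>
    simp only [hn, min_self, Nat.le_add_right, inf_of_le_left, false_and, true_and, if_false,
      add_zero, zero_add]
  · split_ifs <;> first | rfl | omega
  · split_ifs <;> first | rfl | omega
  · split_ifs <;> first | rfl | omega
  · split_ifs <;> first | rfl | omega

/-- Modulo 2, both sides are unchanged when the ends of either edge are swapped, so the orientations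
may be normalized. -/
theorem edgeBelow_add_of_adj {W H : ℕ} {a b c d : Fin W × Fin H}
    (hab : (gridGraph W H).Adj a b) (hcd : (gridGraph W H).Adj c d)
    (hac : a ≠ c) (had : a ≠ d) (hbc : b ≠ c) (hbd : b ≠ d) :
    edgeBelow a c d + edgeBelow b c d + edgeBelow c a b + edgeBelow d a b =
      lexIndicator a c + lexIndicator a d + lexIndicator b c + lexIndicator b d := by
  rw [gridGraph_adj_iff] at hab hcd
  have key : ∀ {a b : Fin W × Fin H}, a ≠ c → a ≠ d → b ≠ c → b ≠ d →
      (((a.1 : ℕ) + 1 = b.1 ∧ (a.2 : ℕ) = b.2) ∨ ((a.2 : ℕ) + 1 = b.2 ∧ (a.1 : ℕ) = b.1)) →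
      edgeBelow a c d + edgeBelow b c d + edgeBelow c a b + edgeBelow d a b =
        lexIndicator a c + lexIndicator a d + lexIndicator b c + lexIndicator b d := by
    intro a b hac had hbc hbd h
    by_cases hc : ((c.1 : ℕ) + 1 = d.1 ∧ (c.2 : ℕ) = d.2) ∨
        ((c.2 : ℕ) + 1 = d.2 ∧ (c.1 : ℕ) = d.1)
    · exact edgeBelow_add_of_oriented h hc hac had hbc hbd
    · have := edgeBelow_add_of_oriented h (c := d) (d := c) (by omega) had hac hbd hbc
      rw [edgeBelow_comm a, edgeBelow_comm b] at this
      linear_combination this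
  by_cases h : ((a.1 : ℕ) + 1 = b.1 ∧ (a.2 : ℕ) = b.2) ∨ ((a.2 : ℕ) + 1 = b.2 ∧ (a.1 : ℕ) = b.1)
  · exact key hac had hbc hbd h
  · have := key hbc hbd hac had (by omega)
    rw [edgeBelow_comm c, edgeBelow_comm d] at this
    linear_combination this

theorem edgeBelow_add_crossBelow {W H : ℕ} {a b c d : Fin W × Fin H}
    (hab : (gridGraph W H).Adj a b) (w : (gridGraph W H).Walk c d)
    (ha : a ∉ w.support) (hb : b ∉ w.support) :
    crossBelow a w + crossBelow b w + edgeBelow c a b + edgeBelow d a b =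
      lexIndicator a c + lexIndicator a d + lexIndicator b c + lexIndicator b d := by
  have h2 : (2 : ZMod 2) = 0 := rfl
  induction w with
  | nil =>
    simp only [crossBelow]
    linear_combination (edgeBelow _ a b - lexIndicator a _ - lexIndicator b _) * h2
  | @cons c m d h w ih =>
    rw [SimpleGraph.Walk.support_cons, List.mem_cons, not_or] at ha hb
    have hs := w.start_mem_support
    have h1 := edgeBelow_add_of_adj hab h ha.1 (ne_of_mem_of_not_mem hs ha.2).symm hb.1
      (ne_of_mem_of_not_mem hs hb.2).symm
    have h3 := ih ha.2 hb.2
    simp only [crossBelow]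
    -- Splitting the walk at `m` introduces each term of `m` twice, which vanishes modulo 2; so the
    -- identity is additive under concatenation.
    linear_combination h1 + h3 - (edgeBelow m a b - lexIndicator a m - lexIndicator b m) * h2

/-- The crossing identity: for two disjoint walks in the grid, the number of ends of one walk that
lie above the other one has the parity that is prescribed by the order of the four ends. -/
theorem crossBelow_add_of_disjoint {W H : ℕ} {a b c d : Fin W × Fin H}
    (w : (gridGraph W H).Walk a b) (w' : (gridGraph W H).Walk c d)
    (h : ∀ x ∈ w.support, x ∉ w'.support) :
    crossBelow a w' + crossBelow b w' + crossBelow c w + crossBelow d w =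
      lexIndicator a c + lexIndicator a d + lexIndicator b c + lexIndicator b d := by
  have h2 : (2 : ZMod 2) = 0 := rfl
  induction w with
  | nil =>
    simp only [crossBelow]
    linear_combination (crossBelow _ w' - lexIndicator _ c - lexIndicator _ d) * h2
  | @cons a m b hadj w ih =>
    have h1 := edgeBelow_add_crossBelow hadj w' (h a (by simp)) (h m (by simp))
    have h3 := ih fun x hx => h x (by simp [hx])
    simp only [crossBelow]
    linear_combination h1 + h3 - (crossBelow m w' - lexIndicator m c - lexIndicator m d) * h2

/-- If `p` and `q` are both joined to the corners of a triangle of walks in a grid, with walks that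
are disjoint as far as possible, then the triangle separates `p` and `q`. -/
theorem crossBelow_triangle_separates {W H : ℕ} {p q : Fin W × Fin H} {a : Fin 3 → Fin W × Fin H}
    (ha : Function.Injective a) (e : ∀ i j, (gridGraph W H).Walk (a i) (a j))
    (f : ∀ i, (gridGraph W H).Walk p (a i)) (g : ∀ i, (gridGraph W H).Walk q (a i))
    (hef : ∀ i j l, l ≠ i → l ≠ j → ∀ x ∈ (f l).support, x ∉ (e i j).support)
    (heg : ∀ i j l, l ≠ i → l ≠ j → ∀ x ∈ (g l).support, x ∉ (e i j).support)
    (hfg : ∀ i j, i ≠ j → ∀ x ∈ (f i).support, x ∉ (g j).support) :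
    (crossBelow p (e 0 1) + crossBelow p (e 1 2) + crossBelow p (e 2 0)) +
      (crossBelow q (e 0 1) + crossBelow q (e 1 2) + crossBelow q (e 2 0)) = 1 := by
  have l1 := lexIndicator_add_swap (ha.ne (show (0 : Fin 3) ≠ 1 by decide))
  have l2 := lexIndicator_add_swap (ha.ne (show (1 : Fin 3) ≠ 2 by decide))
  have l3 := lexIndicator_add_swap (ha.ne (show (2 : Fin 3) ≠ 0 by decide))
  have f0 := crossBelow_add_of_disjoint _ _ (hef 1 2 0 (by decide) (by decide))
  have f1 := crossBelow_add_of_disjoint _ _ (hef 2 0 1 (by decide) (by decide))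
  have f2 := crossBelow_add_of_disjoint _ _ (hef 0 1 2 (by decide) (by decide))
  have g0 := crossBelow_add_of_disjoint _ _ (heg 1 2 0 (by decide) (by decide))
  have g1 := crossBelow_add_of_disjoint _ _ (heg 2 0 1 (by decide) (by decide))
  have g2 := crossBelow_add_of_disjoint _ _ (heg 0 1 2 (by decide) (by decide))
  have k1 := crossBelow_add_of_disjoint _ _ (hfg 0 1 (by decide))
  have k2 := crossBelow_add_of_disjoint _ _ (hfg 0 2 (by decide))
  have k3 := crossBelow_add_of_disjoint _ _ (hfg 1 0 (by decide))
  have k4 := crossBelow_add_of_disjoint _ _ (hfg 1 2 (by decide))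
  have k5 := crossBelow_add_of_disjoint _ _ (hfg 2 0 (by decide))
  have k6 := crossBelow_add_of_disjoint _ _ (hfg 2 1 (by decide))
  -- Add all twelve identities. Terms of `p` and `q` with the walks `f` and `g`, and all order
  -- indicators involving `p` or `q`, occur an even number of times, as do the crossing terms of the
  -- corners. Each of the three families leaves the order indicators of all ordered pairs of
  -- corners, which sum to 3, that is 1. What remains are the crossings below `p` and `q`.
  grind

theorem exists_mem_support_below {W H : ℕ} {v a b : Fin W × Fin H}
    (w : (gridGraph W H).Walk a b) (h : crossBelow v w ≠ 0) :
    ∃ u ∈ w.support, u.1 = v.1 ∧ u.2 < v.2 := by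
  induction w with
  | nil => exact absurd rfl h
  | @cons a m b hadj w ih =>
    by_cases hw : crossBelow v w = 0
    · have hE : edgeBelow v a m ≠ 0 := by simpa [crossBelow, hw] using h
      unfold edgeBelow at hE
      obtain ⟨h1, h2, h3⟩ := of_not_not fun hn => hE (if_neg hn)
      rcases le_total (a.1 : ℕ) m.1 with hle | hle
      · exact ⟨a, by simp, Fin.ext (by omega), Fin.lt_def.mpr h2⟩
      -- The left end of the crossing edge is the one in the column of `v`.
      · exact ⟨m, by simp, Fin.ext (by omega), Fin.lt_def.mpr (by omega)⟩
    · obtain ⟨u, hu, h'⟩ := ih hw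
      exact ⟨u, by simp [hu], h'⟩

theorem exists_mem_support_above {W H : ℕ} {v a b : Fin W × Fin H}
    (w : (gridGraph W H).Walk a b) (h : crossBelow v w ≠ crossColumn v w) :
    ∃ u ∈ w.support, u.1 = v.1 ∧ v.2 ≤ u.2 := by
  induction w with
  | nil => exact absurd rfl h
  | @cons a m b hadj w ih =>
    by_cases hw : crossBelow v w = crossColumn v w
    · have hE : edgeBelow v a m ≠ edgeColumn v a m := by simpa [crossBelow, crossColumn, hw] using h
      unfold edgeBelow edgeColumn at hE
      have h3 : (a.2 : ℕ) = m.2 ∧ ¬((a.2 : ℕ) < v.2) ∧ min (a.1 : ℕ) m.1 = v.1 := by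
        by_contra hn
        refine hE ?_
        split_ifs <;> first | rfl | omega
      obtain ⟨h1, h2, h3⟩ := h3
      rcases le_total (a.1 : ℕ) m.1 with hle | hle
      · exact ⟨a, by simp, Fin.ext (by omega), Fin.le_def.mpr (by omega)⟩
      · exact ⟨m, by simp, Fin.ext (by omega), Fin.le_def.mpr (by omega)⟩
    · obtain ⟨u, hu, h'⟩ := ih hw
      exact ⟨u, by simp [hu], h'⟩

/-- A walk changes sides of the line just right of the column of `v` with each such edge. For a
closed walk the total is even, so an odd number of edges below `v` forces an odd number that are not
below. -/
theorem crossColumn_eq {W H : ℕ} {v a b : Fin W × Fin H} (w : (gridGraph W H).Walk a b) :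
    crossColumn v w = (if a.1 ≤ v.1 then 1 else 0) + (if b.1 ≤ v.1 then 1 else 0) := by
  have h2 : (2 : ZMod 2) = 0 := rfl
  induction w with
  | nil =>
    simp only [crossColumn]
    linear_combination -(if (_ : Fin W) ≤ v.1 then (1 : ZMod 2) else 0) * h2
  | @cons a m b hadj w ih =>
    have hE : edgeColumn v a m =
        (if a.1 ≤ v.1 then 1 else 0) + (if m.1 ≤ v.1 then 1 else 0) := by
      rw [gridGraph_adj_iff] at hadj
      unfold edgeColumn
      simp only [Fin.le_def]
      split_ifs <;> first | rfl | omega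
    simp only [crossColumn]
    linear_combination hE + ih + (if m.1 ≤ v.1 then (1 : ZMod 2) else 0) * h2

/-- A triangle of walks that winds around `v` meets the column of `v` below and above `v`. -/
theorem exists_below_above_of_triangle {W H : ℕ} {v a b c : Fin W × Fin H}
    (w₁ : (gridGraph W H).Walk a b) (w₂ : (gridGraph W H).Walk b c)
    (w₃ : (gridGraph W H).Walk c a) {S : Set (Fin W × Fin H)}
    (h₁ : ∀ x ∈ w₁.support, x ∈ S) (h₂ : ∀ x ∈ w₂.support, x ∈ S) (h₃ : ∀ x ∈ w₃.support, x ∈ S)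
    (hv : v ∉ S) (h : crossBelow v w₁ + crossBelow v w₂ + crossBelow v w₃ ≠ 0) :
    (∃ y, y < v.2 ∧ (v.1, y) ∈ S) ∧ ∃ y, v.2 < y ∧ (v.1, y) ∈ S := by
  have below : ∀ {a b} (w : (gridGraph W H).Walk a b), (∀ x ∈ w.support, x ∈ S) →
      crossBelow v w ≠ 0 → ∃ y, y < v.2 ∧ (v.1, y) ∈ S := by
    intro a b w hS hw
    obtain ⟨u, hu, h1, h2⟩ := exists_mem_support_below w hw
    exact ⟨u.2, h2, h1 ▸ hS u hu⟩
  have above : ∀ {a b} (w : (gridGraph W H).Walk a b), (∀ x ∈ w.support, x ∈ S) →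
      crossBelow v w ≠ crossColumn v w → ∃ y, v.2 < y ∧ (v.1, y) ∈ S := by
    intro a b w hS hw
    obtain ⟨u, hu, h1, h2⟩ := exists_mem_support_above w hw
    have hmem := hS u hu
    -- The point found may be level with `v`, but then it would be `v`, which is not in `S`.
    refine ⟨u.2, lt_of_le_of_ne h2 fun h3 => hv ?_, h1 ▸ hmem⟩
    rwa [show v = u from Prod.ext h1.symm h3]
  constructor
  · by_cases c1 : crossBelow v w₁ = 0
    · by_cases c2 : crossBelow v w₂ = 0
      · exact below w₃ h₃ fun c3 => h (by rw [c1, c2, c3]; rfl)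
      · exact below w₂ h₂ c2
    · exact below w₁ h₁ c1
  · by_cases c1 : crossBelow v w₁ = crossColumn v w₁
    · by_cases c2 : crossBelow v w₂ = crossColumn v w₂
      · refine above w₃ h₃ fun c3 => h ?_
        rw [c1, c2, c3, crossColumn_eq, crossColumn_eq, crossColumn_eq]
        split_ifs <;> rfl
      · exact above w₂ h₂ c2
    · exact above w₁ h₁ c1

/-! ### The height of grid-representations of the nested triangles graph -/

theorem GridRepresentation.exists_walk_of_label_eq {V : Type*} {G : SimpleGraph V} {W H : ℕ}
    (R : GridRepresentation G W H) {p q : Fin W × Fin H} (h : R.label p = R.label q) :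
    ∃ w : (gridGraph W H).Walk p q, ∀ x ∈ w.support, R.label x = R.label p := by
  obtain ⟨w⟩ := (R.connected (R.label p)).preconnected ⟨p, rfl⟩ ⟨q, h.symm⟩
  refine ⟨w.map (SimpleGraph.Embedding.induce _).toHom, fun x hx => ?_⟩
  obtain ⟨y, -, rfl⟩ := List.mem_map.mp
    (SimpleGraph.Walk.support_map (SimpleGraph.Embedding.induce _).toHom w ▸ hx)
  exact y.2

/-- A walk in the represented graph lifts to a walk in the grid between prescribed points. -/
theorem GridRepresentation.exists_walk_lift {V : Type*} {G : SimpleGraph V} {W H : ℕ}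
    (R : GridRepresentation G W H) {u v : V} (w : G.Walk u v) {p q : Fin W × Fin H}
    (hp : R.label p = u) (hq : R.label q = v) :
    ∃ w' : (gridGraph W H).Walk p q, ∀ x ∈ w'.support, R.label x ∈ w.support := by
  induction w generalizing p with
  | nil =>
    obtain ⟨w', hw'⟩ := R.exists_walk_of_label_eq (hp.trans hq.symm)
    exact ⟨w', fun x hx => by simp [hw' x hx, hp]⟩
  | @cons u m v hadj w ih =>
    obtain ⟨p', q', hpq, hp', hq'⟩ := R.edge u m hadj
    obtain ⟨w₁, hw₁⟩ := R.exists_walk_of_label_eq (hp.trans hp'.symm)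
    obtain ⟨w₂, hw₂⟩ := ih hq' hq
    refine ⟨w₁.append (.cons hpq w₂), fun x hx => ?_⟩
    rw [SimpleGraph.Walk.mem_support_append_iff, SimpleGraph.Walk.support_cons,
      List.mem_cons] at hx
    rw [SimpleGraph.Walk.support_cons, List.mem_cons]
    rcases hx with hx | rfl | hx
    · exact .inl ((hw₁ x hx).trans hp)
    · exact .inl hp'
    · exact .inr (hw₂ x hx)

theorem nestedTriangles_exists_walk_corner_zero {k : ℕ} (d : ℕ) (s s' : Fin k)
    (h : (s' : ℕ) = s + d) :
    ∃ w : (nestedTriangles k).Walk (s, 0) (s', 0), ∀ x ∈ w.support, s ≤ x.1 ∧ x.1 ≤ s' := by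
  induction d generalizing s' with
  | zero =>
    obtain rfl : s' = s := Fin.ext h
    exact ⟨.nil, by simp⟩
  | succ d ih =>
    have hs' := s'.isLt
    obtain ⟨w, hw⟩ := ih ⟨s + d, by omega⟩ rfl
    have hadj : (nestedTriangles k).Adj (⟨s + d, by omega⟩, 0) (s', 0) := by
      rw [nestedTriangles_adj_iff]
      simp only [linearIndex]
      omega
    refine ⟨w.append (.cons hadj .nil), fun x hx => ?_⟩
    rw [SimpleGraph.Walk.mem_support_append_iff] at hx
    simp only [SimpleGraph.Walk.support_cons, SimpleGraph.Walk.support_nil, List.mem_cons,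
      List.not_mem_nil, or_false] at hx
    rcases hx with hx | rfl | rfl
    · have := hw x hx
      simp only [Fin.le_def] at *
      omega
    all_goals simp only [Fin.le_def]; omega

/-- The last step starts at corner 2 of the triangle before `t`, the only corner there that is
adjacent to all three corners of `t`. -/
theorem nestedTriangles_exists_walk_from_first {k : ℕ} (o t : Fin k) (ho : (o : ℕ) = 0)
    (ht : 1 ≤ (t : ℕ)) (i : Fin 3) :
    ∃ w : (nestedTriangles k).Walk (o, 0) (t, i), ∀ x ∈ w.support, x.1 < t ∨ x = (t, i) := by
  have htk := t.isLt
  obtain ⟨w, hw⟩ := nestedTriangles_exists_walk_corner_zero (t - 1) o ⟨t - 1, by omega⟩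
    (by simp only; omega)
  have h1 : (nestedTriangles k).Adj (⟨t - 1, by omega⟩, 0) (⟨t - 1, by omega⟩, 2) := by
    rw [nestedTriangles_adj_iff]
    simp only [linearIndex]
    omega
  have h2 : (nestedTriangles k).Adj (⟨t - 1, by omega⟩, 2) (t, i) := by
    rw [nestedTriangles_adj_iff]
    simp only [linearIndex]
    omega
  refine ⟨w.append (.cons h1 (.cons h2 .nil)), fun x hx => ?_⟩
  rw [SimpleGraph.Walk.mem_support_append_iff] at hx
  simp only [SimpleGraph.Walk.support_cons, SimpleGraph.Walk.support_nil, List.mem_cons,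
    List.not_mem_nil, or_false] at hx
  rcases hx with hx | rfl | rfl | rfl
  · have := (hw x hx).2
    simp only [Fin.le_def, Fin.lt_def] at *
    omega
  · exact .inl (Fin.lt_def.mpr (by simp only; omega))
  · exact .inl (Fin.lt_def.mpr (by simp only; omega))
  · exact .inr rfl

/-- Corner 0 of the triangle after `t` is adjacent to all three corners of `t`, so no detour is
needed. -/
theorem nestedTriangles_exists_walk_from_last {k : ℕ} (o t : Fin k) (ho : (o : ℕ) + 1 = k)
    (ht : (t : ℕ) + 1 < k) (i : Fin 3) :
    ∃ w : (nestedTriangles k).Walk (o, 0) (t, i), ∀ x ∈ w.support, t < x.1 ∨ x = (t, i) := by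
  obtain ⟨w, hw⟩ := nestedTriangles_exists_walk_corner_zero (k - 2 - t) ⟨t + 1, ht⟩ o
    (by simp only; omega)
  have h1 : (nestedTriangles k).Adj (⟨t + 1, ht⟩, 0) (t, i) := by
    rw [nestedTriangles_adj_iff]
    simp only [linearIndex]
    omega
  refine ⟨w.reverse.append (.cons h1 .nil), fun x hx => ?_⟩
  rw [SimpleGraph.Walk.mem_support_append_iff] at hx
  simp only [SimpleGraph.Walk.support_cons, SimpleGraph.Walk.support_nil, List.mem_cons,
    List.not_mem_nil, or_false, SimpleGraph.Walk.support_reverse, List.mem_reverse] at hx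
  rcases hx with hx | rfl | rfl
  · have := (hw x hx).1
    simp only [Fin.le_def, Fin.lt_def] at *
    omega
  · exact .inl (Fin.lt_def.mpr (by simp only; omega))
  · exact .inr rfl

/-- The labels in the column of `v`, both below and above `v`, include a corner of the
triangle `t`. -/
def GridRepresentation.EnclosesInColumn {k W H : ℕ}
    (R : GridRepresentation (nestedTriangles k) W H) (t : Fin k) (v : Fin W × Fin H) : Prop :=
  (∃ y, y < v.2 ∧ (R.label (v.1, y)).1 = t) ∧ ∃ y, v.2 < y ∧ (R.label (v.1, y)).1 = t

theorem GridRepresentation.encloses_first_or_last {k W H : ℕ}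
    (R : GridRepresentation (nestedTriangles k) W H) (o o' t : Fin k) (ho : (o : ℕ) = 0)
    (ho' : (o' : ℕ) + 1 = k) (ht : 1 ≤ (t : ℕ)) (ht' : (t : ℕ) + 1 < k) {p q : Fin W × Fin H}
    (hp : R.label p = (o, 0)) (hq : R.label q = (o', 0)) :
    R.EnclosesInColumn t p ∨ R.EnclosesInColumn t q := by
  choose a ha using fun i : Fin 3 => R.label_surjective (t, i)
  have hwalk : ∀ i j : Fin 3, ∃ w : (nestedTriangles k).Walk (t, i) (t, j),
      ∀ x ∈ w.support, x = (t, i) ∨ x = (t, j) := by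
    intro i j
    by_cases hij : i = j
    · subst hij
      exact ⟨.nil, by simp⟩
    · have hadj : (nestedTriangles k).Adj (t, i) (t, j) := by
        rw [nestedTriangles_adj_iff]
        simp only [linearIndex]
        omega
      exact ⟨.cons hadj .nil, by simp⟩
  have he : ∀ i j : Fin 3, ∃ w : (gridGraph W H).Walk (a i) (a j),
      ∀ x ∈ w.support, R.label x = (t, i) ∨ R.label x = (t, j) := by
    intro i j
    obtain ⟨w, hw⟩ := hwalk i j
    obtain ⟨w', hw'⟩ := R.exists_walk_lift w (ha i) (ha j)
    exact ⟨w', fun x hx => hw _ (hw' x hx)⟩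
  have hf : ∀ i : Fin 3, ∃ w : (gridGraph W H).Walk p (a i),
      ∀ x ∈ w.support, (R.label x).1 < t ∨ R.label x = (t, i) := by
    intro i
    obtain ⟨w, hw⟩ := nestedTriangles_exists_walk_from_first o t ho ht i
    obtain ⟨w', hw'⟩ := R.exists_walk_lift w hp (ha i)
    exact ⟨w', fun x hx => hw _ (hw' x hx)⟩
  have hg : ∀ i : Fin 3, ∃ w : (gridGraph W H).Walk q (a i),
      ∀ x ∈ w.support, t < (R.label x).1 ∨ R.label x = (t, i) := by
    intro i
    obtain ⟨w, hw⟩ := nestedTriangles_exists_walk_from_last o' t ho' ht' i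
    obtain ⟨w', hw'⟩ := R.exists_walk_lift w hq (ha i)
    exact ⟨w', fun x hx => hw _ (hw' x hx)⟩
  choose e he using he
  choose f hf using hf
  choose g hg using hg
  have hinj : Function.Injective a := fun i j hij => by
    have := (ha i).symm.trans ((congrArg R.label hij).trans (ha j))
    exact (Prod.mk.inj this).2
  have hsep := crossBelow_triangle_separates hinj e f g
    (by
      intro i j l hi hj x hx hx'
      rcases hf l x hx with h | h <;> rcases he i j x hx' with h' | h' <;> rw [h'] at h
      all_goals first
        | exact lt_irrefl _ h
        | exact hi (Prod.mk.inj h).2.symm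
        | exact hj (Prod.mk.inj h).2.symm)
    (by
      intro i j l hi hj x hx hx'
      rcases hg l x hx with h | h <;> rcases he i j x hx' with h' | h' <;> rw [h'] at h
      all_goals first
        | exact lt_irrefl _ h
        | exact hi (Prod.mk.inj h).2.symm
        | exact hj (Prod.mk.inj h).2.symm)
    (by
      intro i j hij x hx hx'
      rcases hf i x hx with h | h <;> rcases hg j x hx' with h' | h'
      · exact lt_asymm h h'
      · rw [h'] at h; exact lt_irrefl _ h
      · rw [h] at h'; exact lt_irrefl _ h'
      · exact hij (Prod.mk.inj (h.symm.trans h')).2)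
  have hS : ∀ i j, ∀ x ∈ (e i j).support, x ∈ {x | (R.label x).1 = t} := by
    intro i j x hx
    rcases he i j x hx with h | h <;> simp [h]
  by_cases hP : crossBelow p (e 0 1) + crossBelow p (e 1 2) + crossBelow p (e 2 0) = 0
  · refine .inr (exists_below_above_of_triangle _ _ _ (hS 0 1) (hS 1 2) (hS 2 0) ?_ ?_)
    · rw [Set.mem_ofPred_eq, hq]
      rintro rfl
      simp only at ht'
      omega
    · rw [hP, zero_add] at hsep
      rw [hsep]
      exact one_ne_zero
  · refine .inl (exists_below_above_of_triangle _ _ _ (hS 0 1) (hS 1 2) (hS 2 0) ?_ hP)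
    rw [Set.mem_ofPred_eq, hp]
    rintro rfl
    simp only at ht
    omega

/-- Each triangle in `A` occupies its own cell below `v` and its own cell above `v`; the cell of `v`
makes the inequality strict. -/
theorem GridRepresentation.two_mul_card_enclosing_lt {k W H : ℕ}
    (R : GridRepresentation (nestedTriangles k) W H) (v : Fin W × Fin H) (A : Finset (Fin k))
    (hA : ∀ t ∈ A, R.EnclosesInColumn t v) : 2 * A.card < H := by
  have h1 : A.card ≤ (Finset.Iio v.2).card :=
    (Finset.card_le_card (t := (Finset.Iio v.2).image fun y => (R.label (v.1, y)).1)
      fun t ht => by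
        obtain ⟨y, hy, h⟩ := (hA t ht).1
        exact Finset.mem_image.mpr ⟨y, Finset.mem_Iio.mpr hy, h⟩).trans Finset.card_image_le
  have h2 : A.card ≤ (Finset.Ioi v.2).card :=
    (Finset.card_le_card (t := (Finset.Ioi v.2).image fun y => (R.label (v.1, y)).1)
      fun t ht => by
        obtain ⟨y, hy, h⟩ := (hA t ht).2
        exact Finset.mem_image.mpr ⟨y, Finset.mem_Ioi.mpr hy, h⟩).trans Finset.card_image_le
  rw [Fin.card_Iio] at h1
  rw [Fin.card_Ioi] at h2
  have := v.2.isLt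
  omega

theorem GridRepresentation.le_height_add_one {k W H : ℕ} (hk : 2 ≤ k)
    (R : GridRepresentation (nestedTriangles k) W H) : k ≤ H + 1 := by
  classical
  obtain ⟨p, hp⟩ := R.label_surjective (⟨0, by omega⟩, 0)
  obtain ⟨q, hq⟩ := R.label_surjective (⟨k - 1, by omega⟩, 0)
  have hA := R.two_mul_card_enclosing_lt p
    (Finset.univ.filter fun t => R.EnclosesInColumn t p) (by simp)
  have hB := R.two_mul_card_enclosing_lt q
    (Finset.univ.filter fun t => R.EnclosesInColumn t q) (by simp)
  have hsub : Finset.Ioo (⟨0, by omega⟩ : Fin k) ⟨k - 1, by omega⟩ ⊆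
      (Finset.univ.filter fun t => R.EnclosesInColumn t p) ∪
        Finset.univ.filter fun t => R.EnclosesInColumn t q := by
    intro t ht
    rw [Finset.mem_Ioo, Fin.lt_def, Fin.lt_def] at ht
    simp only at ht
    have := R.encloses_first_or_last _ _ t rfl (by simp only; omega) (by omega) (by omega) hp hq
    simpa using this
  -- There are `k - 2` triangles strictly between the first and the last, so `2 * (k - 2) ≤ 2 * (H -
  -- 1)`.
  have hcard := (Finset.card_le_card hsub).trans (Finset.card_union_le _ _)
  rw [Fin.card_Ioo] at hcard
  simp only at hcard
  omega

/-! ### A grid-representation of the nested triangles graph -/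

/-- Two points of a grid are joined within the set of the grid points that satisfy `P`. -/
def GridJoinedIn (W H : ℕ) (P : ℕ → ℕ → Prop) (x y x' y' : ℕ) : Prop :=
  ∃ (hx : x < W) (hy : y < H) (hx' : x' < W) (hy' : y' < H) (h : P x y) (h' : P x' y'),
    ((gridGraph W H).induce {p : Fin W × Fin H | P p.1 p.2}).Reachable
      ⟨(⟨x, hx⟩, ⟨y, hy⟩), h⟩ ⟨(⟨x', hx'⟩, ⟨y', hy'⟩), h'⟩

theorem GridJoinedIn.trans {W H : ℕ} {P : ℕ → ℕ → Prop} {x y x' y' x'' y'' : ℕ} :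
    GridJoinedIn W H P x y x' y' → GridJoinedIn W H P x' y' x'' y'' → GridJoinedIn W H P x y x'' y'' := by
  rintro ⟨hx, hy, _, _, h, _, hr⟩ ⟨_, _, hx'', hy'', _, h'', hr'⟩
  exact ⟨hx, hy, hx'', hy'', h, h'', hr.trans hr'⟩

theorem GridJoinedIn.symm {W H : ℕ} {P : ℕ → ℕ → Prop} {x y x' y' : ℕ} :
    GridJoinedIn W H P x y x' y' → GridJoinedIn W H P x' y' x y := by
  rintro ⟨hx, hy, hx', hy', h, h', hr⟩
  exact ⟨hx', hy', hx, hy, h', h, hr.symm⟩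

theorem gridJoinedIn_horizontal {W H : ℕ} {P : ℕ → ℕ → Prop} {x x' y : ℕ} (hle : x ≤ x') (hx' : x' < W)
    (hy : y < H) (h : ∀ z, x ≤ z → z ≤ x' → P z y) : GridJoinedIn W H P x y x' y := by
  induction x', hle using Nat.le_induction with
  | base => exact ⟨hx', hy, hx', hy, h x le_rfl le_rfl, h x le_rfl le_rfl, .refl _⟩
  | succ x' hle ih =>
    refine (ih (by omega) fun z h1 h2 => h z h1 (by omega)).trans
      ⟨by omega, hy, hx', hy, h x' hle (by omega), h _ (by omega) le_rfl,
        SimpleGraph.Adj.reachable ?_⟩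
    rw [SimpleGraph.comap_adj, gridGraph_adj_iff]
    exact .inl ⟨.inl rfl, rfl⟩

theorem gridJoinedIn_vertical {W H : ℕ} {P : ℕ → ℕ → Prop} {x y y' : ℕ} (hle : y ≤ y') (hx : x < W)
    (hy' : y' < H) (h : ∀ z, y ≤ z → z ≤ y' → P x z) : GridJoinedIn W H P x y x y' := by
  induction y', hle using Nat.le_induction with
  | base => exact ⟨hx, hy', hx, hy', h y le_rfl le_rfl, h y le_rfl le_rfl, .refl _⟩
  | succ y' hle ih =>
    refine (ih (by omega) fun z h1 h2 => h z h1 (by omega)).trans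
      ⟨hx, by omega, hx, hy', h y' hle (by omega), h _ (by omega) le_rfl,
        SimpleGraph.Adj.reachable ?_⟩
    rw [SimpleGraph.comap_adj, gridGraph_adj_iff]
    exact .inr ⟨.inl rfl, rfl⟩

/-- The number of the concentric rectangle, in the grid with `6 k` columns and `2 k` rows, that
contains a point. -/
def ringIndex (k x y : ℕ) : ℕ := max (max (k - 1 - x) (x - 5 * k)) (max (k - 1 - y) (y - k))

/-- The corners `1` and `2` of a triangle occupy intervals in the top row of its rectangle, and the
corner `0` occupies the remainder. -/
def ringCorner (k x y : ℕ) : ℕ :=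
  -- From one rectangle to the next the two intervals together lose one cell at each end, and the
  -- boundary between corners 1 and 2 moves right by one. These shifts put the required pairs of
  -- labels on top of each other. Further adjacencies would do no harm.
  if y = k + ringIndex k x y ∧ k + ringIndex k x y ≤ x ∧ x + ringIndex k x y < 5 * k then
    if x ≤ k + ringIndex k x y + 1 then 1 else 2
  else 0

theorem ringIndex_lt {k x y : ℕ} (hx : x < 6 * k) (hy : y < 2 * k) : ringIndex k x y < k := by
  unfold ringIndex
  omega

theorem ringCorner_lt (k x y : ℕ) : ringCorner k x y < 3 := by
  unfold ringCorner
  split_ifs <;> omega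

/-- The labelling of the grid by the vertices of the nested triangles graph. -/
def ringLabel (k : ℕ) (p : Fin (6 * k) × Fin (2 * k)) : Fin k × Fin 3 :=
  (⟨ringIndex k p.1 p.2, ringIndex_lt p.1.2 p.2.2⟩, ⟨ringCorner k p.1 p.2, ringCorner_lt _ _ _⟩)

theorem ringIndex_eq_iff {k x y t : ℕ} (ht : t < k) (hx : x < 6 * k) (hy : y < 2 * k) :
    ringIndex k x y = t ↔ k ≤ x + 1 + t ∧ x ≤ 5 * k + t ∧ k ≤ y + 1 + t ∧ y ≤ k + t ∧
      (x + 1 + t = k ∨ x = 5 * k + t ∨ y + 1 + t = k ∨ y = k + t) := by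
  unfold ringIndex
  omega

theorem ringCorner_eq {k x y t : ℕ} (h : ringIndex k x y = t) : ringCorner k x y =
    if y = k + t ∧ k + t ≤ x ∧ x + t < 5 * k then (if x ≤ k + t + 1 then 1 else 2) else 0 := by
  rw [ringCorner, h]

/-- The predicate that the grid point `(x, y)` has the label `(t, i)`. -/
def HasRingLabel (k t i x y : ℕ) : Prop := ringIndex k x y = t ∧ ringCorner k x y = i

theorem hasRingLabel_zero_iff {k t x y : ℕ} (ht : t < k) (hx : x < 6 * k) (hy : y < 2 * k) :
    HasRingLabel k t 0 x y ↔ (k ≤ x + 1 + t ∧ x ≤ 5 * k + t ∧ k ≤ y + 1 + t ∧ y ≤ k + t) ∧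
      (x + 1 + t = k ∨ x = 5 * k + t ∨ y + 1 + t = k ∨
        y = k + t ∧ (x < k + t ∨ 5 * k ≤ x + t)) := by
  have key := ringIndex_eq_iff ht hx hy
  constructor
  · rintro ⟨h1, h2⟩
    rw [ringCorner_eq h1] at h2
    rw [key] at h1
    split_ifs at h2 <;> omega
  · intro h
    have h1 := key.mpr (by omega)
    refine ⟨h1, ?_⟩
    rw [ringCorner_eq h1]
    split_ifs <;> omega

theorem hasRingLabel_one_iff {k t x y : ℕ} (ht : t < k) (hx : x < 6 * k) (hy : y < 2 * k) :
    HasRingLabel k t 1 x y ↔ y = k + t ∧ k + t ≤ x ∧ x ≤ k + t + 1 := by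
  have key := ringIndex_eq_iff ht hx hy
  constructor
  · rintro ⟨h1, h2⟩
    rw [ringCorner_eq h1] at h2
    rw [key] at h1
    split_ifs at h2 <;> omega
  · intro h
    have h1 := key.mpr (by omega)
    refine ⟨h1, ?_⟩
    rw [ringCorner_eq h1]
    split_ifs <;> omega

theorem hasRingLabel_two_iff {k t x y : ℕ} (ht : t < k) (hx : x < 6 * k) (hy : y < 2 * k) :
    HasRingLabel k t 2 x y ↔ y = k + t ∧ k + t + 1 < x ∧ x + t < 5 * k := by
  have key := ringIndex_eq_iff ht hx hy
  constructor
  · rintro ⟨h1, h2⟩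
    rw [ringCorner_eq h1] at h2
    rw [key] at h1
    split_ifs at h2 <;> omega
  · intro h
    have h1 := key.mpr (by omega)
    refine ⟨h1, ?_⟩
    rw [ringCorner_eq h1]
    split_ifs <;> omega

/-- The remainder of the rectangle is connected: every point of it is reached from the lower left
corner along the left side, or along the bottom and the right side, and then along an end piece of
the top row. -/
theorem gridJoinedIn_hasRingLabel_zero {k t x y : ℕ} (ht : t < k) (hx : x < 6 * k) (hy : y < 2 * k)
    (h : HasRingLabel k t 0 x y) :
    GridJoinedIn (6 * k) (2 * k) (HasRingLabel k t 0) (k - 1 - t) (k - 1 - t) x y := by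
  have key : ∀ {x y}, x < 6 * k → y < 2 * k →
      (k ≤ x + 1 + t ∧ x ≤ 5 * k + t ∧ k ≤ y + 1 + t ∧ y ≤ k + t) ∧
        (x + 1 + t = k ∨ x = 5 * k + t ∨ y + 1 + t = k ∨
          y = k + t ∧ (x < k + t ∨ 5 * k ≤ x + t)) → HasRingLabel k t 0 x y :=
    fun hx hy => (hasRingLabel_zero_iff ht hx hy).mpr
  have hleft : ∀ y, k - 1 - t ≤ y → y ≤ k + t →
      GridJoinedIn (6 * k) (2 * k) (HasRingLabel k t 0) (k - 1 - t) (k - 1 - t) (k - 1 - t) y :=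
    fun y h1 h2 => gridJoinedIn_vertical h1 (by omega) (by omega)
      fun z _ _ => key (by omega) (by omega) (by omega)
  have hbottom : ∀ x, k - 1 - t ≤ x → x ≤ 5 * k + t →
      GridJoinedIn (6 * k) (2 * k) (HasRingLabel k t 0) (k - 1 - t) (k - 1 - t) x (k - 1 - t) :=
    fun x h1 h2 => gridJoinedIn_horizontal h1 (by omega) (by omega)
      fun z _ _ => key (by omega) (by omega) (by omega)
  have hright : ∀ y, k - 1 - t ≤ y → y ≤ k + t →
      GridJoinedIn (6 * k) (2 * k) (HasRingLabel k t 0) (k - 1 - t) (k - 1 - t) (5 * k + t) y :=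
    fun y h1 h2 => (hbottom (5 * k + t) (by omega) le_rfl).trans
      (gridJoinedIn_vertical h1 (by omega) (by omega)
        fun z _ _ => key (by omega) (by omega) (by omega))
  obtain ⟨⟨h1, h2, h3, h4⟩, h | h | h | ⟨h, h' | h'⟩⟩ := (hasRingLabel_zero_iff ht hx hy).mp h
  · obtain rfl : x = k - 1 - t := by omega
    exact hleft y (by omega) h4
  · obtain rfl := h
    exact hright y (by omega) h4
  · obtain rfl : y = k - 1 - t := by omega
    exact hbottom x (by omega) h2
  · obtain rfl := h
    exact (hleft (k + t) (by omega) le_rfl).trans (gridJoinedIn_horizontal (by omega) hx hy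
      fun z _ _ => key (by omega) (by omega) (by omega))
  · obtain rfl := h
    exact (hright (k + t) (by omega) le_rfl).trans (gridJoinedIn_horizontal h2 (by omega) hy
      fun z _ _ => key (by omega) (by omega) (by omega)).symm

theorem exists_gridJoinedIn_hasRingLabel {k t i : ℕ} (hk : 2 ≤ k) (ht : t < k) (hi : i < 3) :
    ∃ x₀ y₀, x₀ < 6 * k ∧ y₀ < 2 * k ∧ HasRingLabel k t i x₀ y₀ ∧
      ∀ x y, x < 6 * k → y < 2 * k → HasRingLabel k t i x y →
      GridJoinedIn (6 * k) (2 * k) (HasRingLabel k t i) x₀ y₀ x y := by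
  interval_cases i
  · exact ⟨k - 1 - t, k - 1 - t, by omega, by omega,
      (hasRingLabel_zero_iff ht (by omega) (by omega)).mpr (by omega),
      fun x y hx hy h => gridJoinedIn_hasRingLabel_zero ht hx hy h⟩
  · refine ⟨k + t, k + t, by omega, by omega,
      (hasRingLabel_one_iff ht (by omega) (by omega)).mpr (by omega), fun x y hx hy h => ?_⟩
    obtain ⟨rfl, h1, h2⟩ := (hasRingLabel_one_iff ht hx hy).mp h
    exact gridJoinedIn_horizontal h1 hx hy fun z _ _ =>
      (hasRingLabel_one_iff ht (by omega) hy).mpr (by omega)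
  · refine ⟨k + t + 2, k + t, by omega, by omega,
      (hasRingLabel_two_iff ht (by omega) (by omega)).mpr (by omega), fun x y hx hy h => ?_⟩
    obtain ⟨rfl, h1, h2⟩ := (hasRingLabel_two_iff ht hx hy).mp h
    exact gridJoinedIn_horizontal h1 hx hy fun z _ _ =>
      (hasRingLabel_two_iff ht (by omega) hy).mpr (by omega)

theorem ringLabel_eq_iff {k : ℕ} (p : Fin (6 * k) × Fin (2 * k)) (v : Fin k × Fin 3) :
    ringLabel k p = v ↔ HasRingLabel k v.1 v.2 p.1 p.2 := by
  simp only [ringLabel, HasRingLabel, Prod.ext_iff, Fin.ext_iff]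

theorem ringLabel_edge {k : ℕ} {u v : Fin k × Fin 3} (hlt : linearIndex u < linearIndex v)
    (hle : linearIndex v ≤ linearIndex u + 3) :
    ∃ p q, (gridGraph (6 * k) (2 * k)).Adj p q ∧ ringLabel k p = u ∧ ringLabel k q = v := by
  obtain ⟨⟨t, ht⟩, ⟨i, hi⟩⟩ := u
  obtain ⟨⟨s, hs⟩, ⟨j, hj⟩⟩ := v
  simp only [linearIndex] at hlt hle
  suffices h : ∃ x y x' y', x < 6 * k ∧ y < 2 * k ∧ x' < 6 * k ∧ y' < 2 * k ∧
      (x + 1 = x' ∧ y = y' ∨ x' + 1 = x ∧ y = y' ∨ y + 1 = y' ∧ x = x') ∧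
      HasRingLabel k t i x y ∧ HasRingLabel k s j x' y' by
    obtain ⟨x, y, x', y', hx, hy, hx', hy', hadj, h, h'⟩ := h
    refine ⟨(⟨x, hx⟩, ⟨y, hy⟩), (⟨x', hx'⟩, ⟨y', hy'⟩), ?_, (ringLabel_eq_iff _ _).mpr h,
      (ringLabel_eq_iff _ _).mpr h'⟩
    rw [gridGraph_adj_iff]
    simp only
    omega
  have h0 : ∀ {t x y : ℕ}, t < k → x < 6 * k → y < 2 * k →
      k ≤ x + 1 + t ∧ x ≤ 5 * k + t ∧ y = k + t ∧ (x < k + t ∨ 5 * k ≤ x + t) →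
      HasRingLabel k t 0 x y :=
    fun ht hx hy h => (hasRingLabel_zero_iff ht hx hy).mpr (by omega)
  have h1 : ∀ {t x y : ℕ}, t < k → x < 6 * k → y < 2 * k →
      y = k + t ∧ k + t ≤ x ∧ x ≤ k + t + 1 → HasRingLabel k t 1 x y :=
    fun ht hx hy => (hasRingLabel_one_iff ht hx hy).mpr
  have h2 : ∀ {t x y : ℕ}, t < k → x < 6 * k → y < 2 * k →
      y = k + t ∧ k + t + 1 < x ∧ x + t < 5 * k → HasRingLabel k t 2 x y :=
    fun ht hx hy => (hasRingLabel_two_iff ht hx hy).mpr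
  have hcases : (s = t ∧ i < j) ∨ (s = t + 1 ∧ j ≤ i) := by omega
  -- The three edges within a triangle are realized horizontally in its top row, the six edges to
  -- the next triangle vertically between consecutive top rows.
  rcases hcases with ⟨rfl, hij⟩ | ⟨rfl, hij⟩ <;> interval_cases i <;> interval_cases j
  · exact ⟨k + s - 1, k + s, k + s, k + s, by omega, by omega, by omega, by omega, by omega,
      h0 ht (by omega) (by omega) (by omega), h1 ht (by omega) (by omega) (by omega)⟩
  · exact ⟨5 * k - s, k + s, 5 * k - s - 1, k + s, by omega, by omega, by omega, by omega,
      by omega, h0 ht (by omega) (by omega) (by omega), h2 ht (by omega) (by omega) (by omega)⟩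
  · exact ⟨k + s + 1, k + s, k + s + 2, k + s, by omega, by omega, by omega, by omega, by omega,
      h1 ht (by omega) (by omega) (by omega), h2 ht (by omega) (by omega) (by omega)⟩
  · exact ⟨k + t - 1, k + t, k + t - 1, k + t + 1, by omega, by omega, by omega, by omega,
      by omega, h0 ht (by omega) (by omega) (by omega), h0 hs (by omega) (by omega) (by omega)⟩
  · exact ⟨k + t, k + t, k + t, k + t + 1, by omega, by omega, by omega, by omega,
      by omega, h1 ht (by omega) (by omega) (by omega), h0 hs (by omega) (by omega) (by omega)⟩
  · exact ⟨k + t + 1, k + t, k + t + 1, k + t + 1, by omega, by omega, by omega, by omega,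
      by omega, h1 ht (by omega) (by omega) (by omega), h1 hs (by omega) (by omega) (by omega)⟩
  · exact ⟨5 * k - t - 1, k + t, 5 * k - t - 1, k + t + 1, by omega, by omega, by omega, by omega,
      by omega, h2 ht (by omega) (by omega) (by omega), h0 hs (by omega) (by omega) (by omega)⟩
  · exact ⟨k + t + 2, k + t, k + t + 2, k + t + 1, by omega, by omega, by omega, by omega,
      by omega, h2 ht (by omega) (by omega) (by omega), h1 hs (by omega) (by omega) (by omega)⟩
  · exact ⟨k + t + 3, k + t, k + t + 3, k + t + 1, by omega, by omega, by omega, by omega,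
      by omega, h2 ht (by omega) (by omega) (by omega), h2 hs (by omega) (by omega) (by omega)⟩

/-- The grid-representation of the nested triangles graph by concentric rectangles. -/
def ringRepresentation (k : ℕ) (hk : 2 ≤ k) :
    GridRepresentation (nestedTriangles k) (6 * k) (2 * k) where
  label := ringLabel k
  label_surjective v := by
    obtain ⟨x, y, hx, hy, h, -⟩ := exists_gridJoinedIn_hasRingLabel hk v.1.2 v.2.2
    exact ⟨(⟨x, hx⟩, ⟨y, hy⟩), (ringLabel_eq_iff _ _).mpr h⟩
  connected v := by
    obtain ⟨x, y, hx, hy, h, hjoin⟩ := exists_gridJoinedIn_hasRingLabel hk v.1.2 v.2.2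
    have hset : {p | ringLabel k p = v} =
        {p : Fin (6 * k) × Fin (2 * k) | HasRingLabel k v.1 v.2 p.1 p.2} :=
      Set.ext fun p => ringLabel_eq_iff p v
    rw [hset, SimpleGraph.connected_iff_exists_forall_reachable]
    refine ⟨⟨(⟨x, hx⟩, ⟨y, hy⟩), h⟩, ?_⟩
    rintro ⟨⟨x', y'⟩, hp⟩
    obtain ⟨_, _, _, _, _, _, hr⟩ := hjoin x' y' x'.2 y'.2 hp
    exact hr
  edge u v h := by
    rw [nestedTriangles_adj_iff] at h
    rcases Nat.lt_or_gt_of_ne h.1 with hlt | hlt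
    · exact ringLabel_edge hlt h.2.2
    · obtain ⟨p, q, hpq, hp, hq⟩ := ringLabel_edge hlt h.2.1
      exact ⟨q, p, hpq.symm, hq, hp⟩

/-! ### The grid-major height and the main theorem -/

theorem le_gridMajorHeight_add_one (k : ℕ) (hk : 2 ≤ k) :
    k ≤ gridMajorHeight (nestedTriangles k) + 1 := by
  -- The infimum is attained because the set of heights contains `2 * k`.
  obtain ⟨W, ⟨R⟩⟩ := Nat.sInf_mem (s := {H | ∃ W, Nonempty (GridRepresentation
    (nestedTriangles k) W H)}) ⟨2 * k, 6 * k, ⟨ringRepresentation k hk⟩⟩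
  exact R.le_height_add_one hk

theorem mainTheorem8 (k : ℕ) (hk : 2 ≤ k) :
    IsPlanarTriangulated (nestedTriangles k) ∧
    pathwidth (nestedTriangles k) = 3 ∧
    (Fintype.card (Fin k × Fin 3) : ℝ) / 3 - 1 ≤ (gridMajorHeight (nestedTriangles k) : ℝ) := by
  refine ⟨isPlanarTriangulated_nestedTriangles k hk, pathwidth_nestedTriangles k hk, ?_⟩
  have h : (k : ℝ) ≤ gridMajorHeight (nestedTriangles k) + 1 := by
    exact_mod_cast le_gridMajorHeight_add_one k hk
  rw [Fintype.card_prod, Fintype.card_fin, Fintype.card_fin]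
  push_cast
  linarith
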